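/- Setting. Let $G\subset \operatorname{GL}(n,\mathbb{R})$ be a subgroup that is cut out by polynomial equations in the matrix entries and is stable under transposition, so that $\theta(g)=(g^{t})^{-1}$ is a Cartan involution of $G$. Let $\mathfrak g$ be its Lie algebra and $\mathfrak s=\{X\in\mathfrak g\mid X^t=X\}$, let $\mathfrak a\subset\mathfrak s$ be a maximal abelian subspace, $\Sigma\subset\mathfrak a^*\setminus\{0\}$ the set of roots of $\mathfrak a$ in $\mathfrak g$ with root spaces $\mathfrak g^\alpha$, $\Sigma^+\subset\Sigma$ a system of positive roots and $\mathfrak n=\sum_{\alpha\in\Sigma^+}\mathfrak g^\alpha$. Let $G_{\mathbb C}\subset\operatorname{GL}(n,\mathbb C)$ be the Zariski closure of $G$, $K_{\mathbb C}=\{g\in G_{\mathbb C}\mid g^tg=1\}$, and let $z_0$ be the base point of $Z_{\mathbb C}=G_{\mathbb C}/K_{\mathbb C}$. With $\Omega=\{X\in\mathfrak a\mid \alpha(X)<\pi/2 \text{ for all }\alpha\in\Sigma\}$, the crown domain of $G$ is $$\Xi(G)=G\exp(i\Omega)\cdot z_0\subset Z_{\mathbb C},$$ and $\Lambda=\Lambda(G)\subset\mathfrak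 n$ is the connected component containing $0$ of $\{Y\in\mathfrak n\mid \exp(iY)\cdot z_0\in\Xi(G)\}$. We say that the crown of $G$ embeds into that of $\operatorname{GL}(n,\mathbb R)$ if the natural injection $G_{\mathbb C}/K_{\mathbb C}\to \operatorname{GL}(n,\mathbb C)/\operatorname{O}(n,\mathbb C)$ maps $\Xi(G)$ into $\Xi(\operatorname{GL}(n,\mathbb R))$. Proposition. For all choices of $\mathfrak a$ and $\Sigma^+$ the following hold. 1. For $G=\operatorname{GL}(n,\mathbb R)$, $n\ge 0$, the set $\Lambda\subset\mathfrak n$ is bounded. 2. If $G\subset\operatorname{GL}(n,\mathbb R)$ is as above and the crown of $G$ embeds into that of $\operatorname{GL}(n,\mathbb R)$, then $\Lambda(G)$ is bounded. 3. For each of the groups $\operatorname{SL}(n,\mathbb R)$, $\operatorname{Sp}(n,\mathbb R)\subset\operatorname{GL}(2n,\mathbb R)$, $\operatorname{Sp}(p,q)\subset\operatorname{GL}(4(p+q),\mathbb R)$ and $\operatorname{SU}(p,q)\subset\operatorname{GL}(2(p+q),\mathbb R)$ (embedded through $\mathbb H=\mathbb R^4$, respectively $\mathbb C=\mathbb R^2$),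 the crown embeds into that of the ambient general linear group, and $\Lambda$ is bounded. -/

import Mathlib

open scoped Matrix Quaternion

noncomputable section

namespace Crown

variable {ι : Type*} [Fintype ι] [DecidableEq ι]

/-! ### Linear groups, complexifications, exponentials -/

/-- A subgroup of `GL(ι, 𝕜)` cut out by polynomial equations in the matrix entries. -/
def IsZariskiClosed {𝕜 : Type*} [Field 𝕜] (H : Subgroup (GL ι 𝕜)) : Prop :=
  ∃ S : Set (MvPolynomial (ι × ι) 𝕜), ∀ g : GL ι 𝕜,
    g ∈ H ↔ ∀ P ∈ S, MvPolynomial.eval (fun ij : ι × ι => (g : Matrix ι ι 𝕜) ij.1 ij.2) P = 0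

/-- The group `G` is stable under transposition. Then `g ↦ (gᵀ)⁻¹` restricts to a Cartan
involution `θ` of `G`. -/
def IsSelfAdjoint (G : Subgroup (GL ι ℝ)) : Prop :=
  ∀ g ∈ G, ∃ h ∈ G, (h : Matrix ι ι ℝ) = (g : Matrix ι ι ℝ)ᵀ

/-- The inclusion `GL(ι, ℝ) → GL(ι, ℂ)`. -/
def toComplex : GL ι ℝ →* GL ι ℂ := Matrix.GeneralLinearGroup.map Complex.ofRealHom

/-- The complexification `G_ℂ`: the smallest Zariski closed subgroup of `GL(ι, ℂ)` that
contains `G`, i.e. the Zariski closure of `G`. -/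
def complexification (G : Subgroup (GL ι ℝ)) : Subgroup (GL ι ℂ) :=
  sInf {H | IsZariskiClosed H ∧ G.map toComplex ≤ H}

/-- The complex orthogonal group `O(ι, ℂ) = {g | gᵀ g = 1}` (transposition without complex
conjugation), the fixed points of the holomorphic involution `g ↦ (gᵀ)⁻¹` of `GL(ι, ℂ)`. -/
def complexOrthogonal (ι : Type*) [Fintype ι] [DecidableEq ι] : Subgroup (GL ι ℂ) where
  carrier := {g | (g : Matrix ι ι ℂ)ᵀ * (g : Matrix ι ι ℂ) = 1}
  one_mem' := by simp
  mul_mem' {a b} ha hb := by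
    simp only [Set.mem_ofPred_eq, Units.val_mul, Matrix.transpose_mul] at *
    rw [Matrix.mul_assoc, ← Matrix.mul_assoc _ (a : Matrix ι ι ℂ), ha, Matrix.one_mul, hb]
  inv_mem' {a} ha := by
    simp only [Set.mem_ofPred_eq] at *
    have h : (a : Matrix ι ι ℂ)ᵀ = ((a⁻¹ : GL ι ℂ) : Matrix ι ι ℂ) := by
      calc (a : Matrix ι ι ℂ)ᵀ
          = (a : Matrix ι ι ℂ)ᵀ * ((a : Matrix ι ι ℂ) * ((a⁻¹ : GL ι ℂ) : Matrix ι ι ℂ)) := by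
            rw [Units.mul_inv, Matrix.mul_one]
        _ = _ := by rw [← Matrix.mul_assoc, ha, Matrix.one_mul]
    rw [← h, Matrix.transpose_transpose, h, Units.mul_inv]

/-- `K_ℂ`: the fixed points in `G_ℂ` of the holomorphic extension `g ↦ (gᵀ)⁻¹` of the Cartan
involution. -/
def KC (G : Subgroup (GL ι ℝ)) : Subgroup (GL ι ℂ) :=
  complexification G ⊓ complexOrthogonal ι

theorem KC_mono {G H : Subgroup (GL ι ℝ)} (h : G ≤ H) : KC G ≤ KC H :=
  inf_le_inf_right _ (sInf_le_sInf fun _ hL => ⟨hL.1, (Subgroup.map_mono h).trans hL.2⟩)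

/-- The matrix exponential, as an element of the general linear group. -/
def expGL {𝕜 : Type*} [RCLike 𝕜] (X : Matrix ι ι 𝕜) : GL ι 𝕜 := (Matrix.isUnit_exp X).unit

/-- `exp(iX)` for a real matrix `X`. -/
def expI (X : Matrix ι ι ℝ) : GL ι ℂ :=
  expGL (Complex.I • X.map (fun x : ℝ => (x : ℂ)))

/-! ### Restricted roots -/

/-- The Lie algebra `𝔤 = {X | exp(tX) ∈ G for all real t}` of a closed linear group. -/
def lieAlg (G : Subgroup (GL ι ℝ)) : Set (Matrix ι ι ℝ) :=
  {X | ∀ t : ℝ, expGL (t • X) ∈ G}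

/-- `𝔞` consists of pairwise commuting elements of `𝔰`, where `𝔰` is the `-1` eigenspace in
`𝔤` of the Cartan involution `X ↦ -Xᵀ`, i.e. the set of symmetric matrices in `𝔤`. -/
def IsAbelianInS (G : Subgroup (GL ι ℝ)) (𝔞 : Submodule ℝ (Matrix ι ι ℝ)) : Prop :=
  (∀ X ∈ 𝔞, X ∈ lieAlg G ∧ X.IsSymm) ∧ ∀ X ∈ 𝔞, ∀ Y ∈ 𝔞, X * Y = Y * X

/-- `𝔞` is a maximal abelian subspace of `𝔰`. -/
def IsMaximalAbelian (G : Subgroup (GL ι ℝ)) (𝔞 : Submodule ℝ (Matrix ι ι ℝ)) : Prop :=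
  IsAbelianInS G 𝔞 ∧ ∀ 𝔟, IsAbelianInS G 𝔟 → 𝔞 ≤ 𝔟 → 𝔟 = 𝔞

/-- The root space `𝔤^α = {X ∈ 𝔤 | [H, X] = α(H) X for all H ∈ 𝔞}`. -/
def rootSpace (G : Subgroup (GL ι ℝ)) (𝔞 : Submodule ℝ (Matrix ι ι ℝ))
    (α : Module.Dual ℝ 𝔞) : Set (Matrix ι ι ℝ) :=
  {X | X ∈ lieAlg G ∧
    ∀ H : 𝔞, (H : Matrix ι ι ℝ) * X - X * (H : Matrix ι ι ℝ) = α H • X}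

/-- The set `Σ ⊂ 𝔞* \ {0}` of restricted roots. -/
def roots (G : Subgroup (GL ι ℝ)) (𝔞 : Submodule ℝ (Matrix ι ι ℝ)) :
    Set (Module.Dual ℝ 𝔞) :=
  {α | α ≠ 0 ∧ ∃ X ∈ rootSpace G 𝔞 α, X ≠ 0}

/-- `Φ` is a system of positive roots: the roots that are positive on some regular element. -/
def IsPositiveSystem (G : Subgroup (GL ι ℝ)) (𝔞 : Submodule ℝ (Matrix ι ι ℝ))
    (Φ : Set (Module.Dual ℝ 𝔞)) : Prop :=
  ∃ H : 𝔞, (∀ α ∈ roots G 𝔞, α H ≠ 0) ∧ Φ = {α ∈ roots G 𝔞 | 0 < α H}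

/-- `𝔫`, the sum of the root spaces of the positive roots. -/
def nilradical (G : Subgroup (GL ι ℝ)) (𝔞 : Submodule ℝ (Matrix ι ι ℝ))
    (Φ : Set (Module.Dual ℝ 𝔞)) : Submodule ℝ (Matrix ι ι ℝ) :=
  Submodule.span ℝ (⋃ α ∈ Φ, rootSpace G 𝔞 α)

/-! ### The crown domain and its unipotent model -/

/-- `Ω = {X ∈ 𝔞 | α(X) < π/2 for all roots α}`. -/
def Omega (G : Subgroup (GL ι ℝ)) (𝔞 : Submodule ℝ (Matrix ι ι ℝ)) : Set (Matrix ι ι ℝ) :=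
  {X | ∃ hX : X ∈ 𝔞, ∀ α ∈ roots G 𝔞, α ⟨X, hX⟩ < Real.pi / 2}

/-- The base point `z₀`. The space `Z_ℂ = G_ℂ / K_ℂ` is the `G_ℂ`-orbit of `z₀` in
`GL(ι, ℂ) / K_ℂ`; it contains all the points `g exp(iX) · z₀` with `g ∈ G` and `X ∈ 𝔤`. -/
def basePoint (G : Subgroup (GL ι ℝ)) : GL ι ℂ ⧸ KC G := QuotientGroup.mk 1

/-- The crown domain `Ξ = G exp(iΩ) · z₀`. -/
def crown (G : Subgroup (GL ι ℝ)) (𝔞 : Submodule ℝ (Matrix ι ι ℝ)) : Set (GL ι ℂ ⧸ KC G) :=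
  {z | ∃ g ∈ G, ∃ X ∈ Omega G 𝔞, z = (toComplex g * expI X) • basePoint G}

/-- The domain `Λ`: the connected component containing `0` of
`{Y ∈ 𝔫 | exp(iY) · z₀ ∈ Ξ}`. -/
def Lambda (G : Subgroup (GL ι ℝ)) (𝔞 : Submodule ℝ (Matrix ι ι ℝ))
    (Φ : Set (Module.Dual ℝ 𝔞)) : Set (Matrix ι ι ℝ) :=
  connectedComponentIn
    {Y | Y ∈ nilradical G 𝔞 Φ ∧ expI Y • basePoint G ∈ crown G 𝔞} 0

/-- Boundedness of a set of real matrices (with respect to one, equivalently any, norm). -/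
def IsBoundedSet (S : Set (Matrix ι ι ℝ)) : Prop :=
  ∃ C : ℝ, ∀ Y ∈ S, ∀ i j, |Y i j| ≤ C

/-- The crown of `G` embeds into the crown of `GL(ι, ℝ)`: the natural map
`G_ℂ / K_ℂ → GL(ι, ℂ) / O(ι, ℂ)`, which is injective because `K_ℂ = G_ℂ ∩ O(ι, ℂ)`, sends the
crown of `G` into the crown of `GL(ι, ℝ)`. Here `𝔞` and `𝔟` are the maximal abelian subspaces
through which the two crowns are described. -/
def CrownEmbeds (G : Subgroup (GL ι ℝ)) (𝔞 𝔟 : Submodule ℝ (Matrix ι ι ℝ)) : Prop :=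
  Set.MapsTo (Subgroup.quotientMapOfLE (KC_mono (le_top : G ≤ ⊤)))
    (crown G 𝔞) (crown (⊤ : Subgroup (GL ι ℝ)) 𝔟)

/-! ### The classical groups -/

/-- `SL(n, ℝ)`. -/
def slReal (n : ℕ) : Subgroup (GL (Fin n) ℝ) := Matrix.GeneralLinearGroup.det.ker

/-- `Sp(n, ℝ)`, the symplectic group of rank `n`, acting on `ℝ²ⁿ`. -/
def spReal (n : ℕ) : Subgroup (GL (Fin n ⊕ Fin n) ℝ) where
  carrier := {g | (g : Matrix (Fin n ⊕ Fin n) (Fin n ⊕ Fin n) ℝ) ∈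
    Matrix.symplecticGroup (Fin n) ℝ}
  one_mem' := one_mem (Matrix.symplecticGroup (Fin n) ℝ)
  mul_mem' ha hb := (Matrix.symplecticGroup (Fin n) ℝ).mul_mem ha hb
  inv_mem' {a} ha := by
    let b : Matrix.symplecticGroup (Fin n) ℝ := ⟨(a : Matrix _ _ ℝ), ha⟩
    have h : (b⁻¹ * b : Matrix.symplecticGroup (Fin n) ℝ).1 = 1 := by
      rw [inv_mul_cancel]; rfl
    have h1 : (b⁻¹ : Matrix.symplecticGroup (Fin n) ℝ).1 *
        (a : Matrix (Fin n ⊕ Fin n) (Fin n ⊕ Fin n) ℝ) = 1 := h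
    have h2 : ((a⁻¹ : GL (Fin n ⊕ Fin n) ℝ) : Matrix (Fin n ⊕ Fin n) (Fin n ⊕ Fin n) ℝ) =
        (b⁻¹ : Matrix.symplecticGroup (Fin n) ℝ).1 :=
      Units.inv_eq_of_mul_eq_one_left h1
    simp only [Set.mem_ofPred_eq]
    rw [h2]
    exact (b⁻¹).2

/-- The diagonal matrix with `p` entries `1` and `q` entries `-1`. -/
def signature (D : Type*) [Ring D] (p q : ℕ) : Matrix (Fin p ⊕ Fin q) (Fin p ⊕ Fin q) D :=
  Matrix.diagonal (Sum.elim (fun _ => 1) (fun _ => -1))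

/-- The group of invertible matrices over `D` that preserve the sesquilinear form
`∑ i ≤ p, x̄ᵢ yᵢ - ∑ i > p, x̄ᵢ yᵢ` of signature `(p, q)`. -/
def indefiniteUnitary (D : Type*) [Ring D] [StarRing D] (p q : ℕ) :
    Subgroup (Matrix (Fin p ⊕ Fin q) (Fin p ⊕ Fin q) D)ˣ where
  carrier := {g | (g : Matrix (Fin p ⊕ Fin q) (Fin p ⊕ Fin q) D)ᴴ * signature D p q *
    (g : Matrix (Fin p ⊕ Fin q) (Fin p ⊕ Fin q) D) = signature D p q}
  one_mem' := by simp
  mul_mem' {a b} ha hb := by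
    simp only [Set.mem_ofPred_eq, Units.val_mul, Matrix.conjTranspose_mul] at *
    calc _ = (b : Matrix (Fin p ⊕ Fin q) (Fin p ⊕ Fin q) D)ᴴ *
          ((a : Matrix (Fin p ⊕ Fin q) (Fin p ⊕ Fin q) D)ᴴ * signature D p q *
          (a : Matrix (Fin p ⊕ Fin q) (Fin p ⊕ Fin q) D)) *
          (b : Matrix (Fin p ⊕ Fin q) (Fin p ⊕ Fin q) D) := by simp only [Matrix.mul_assoc]
      _ = _ := by rw [ha, hb]
  inv_mem' {a} ha := by
    simp only [Set.mem_ofPred_eq] at *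
    have h : (a : Matrix (Fin p ⊕ Fin q) (Fin p ⊕ Fin q) D) *
        ((a⁻¹ : (Matrix (Fin p ⊕ Fin q) (Fin p ⊕ Fin q) D)ˣ) :
          Matrix (Fin p ⊕ Fin q) (Fin p ⊕ Fin q) D) = 1 := Units.mul_inv a
    have h' := congrArg Matrix.conjTranspose h
    rw [Matrix.conjTranspose_mul, Matrix.conjTranspose_one] at h'
    generalize ((a⁻¹ : (Matrix (Fin p ⊕ Fin q) (Fin p ⊕ Fin q) D)ˣ) :
          Matrix (Fin p ⊕ Fin q) (Fin p ⊕ Fin q) D) = b at *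
    calc bᴴ * signature D p q * b = bᴴ * ((a : Matrix (Fin p ⊕ Fin q) (Fin p ⊕ Fin q) D)ᴴ *
          signature D p q * (a : Matrix (Fin p ⊕ Fin q) (Fin p ⊕ Fin q) D)) * b := by rw [ha]
      _ = (bᴴ * (a : Matrix (Fin p ⊕ Fin q) (Fin p ⊕ Fin q) D)ᴴ) * signature D p q *
          ((a : Matrix (Fin p ⊕ Fin q) (Fin p ⊕ Fin q) D) * b) := by
            simp only [Matrix.mul_assoc]
      _ = _ := by rw [h', h, Matrix.one_mul, Matrix.mul_one]

/-- Restriction of scalars to `ℝ`: an invertible matrix over a real algebra `D` with basis `b`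
becomes a real matrix, every entry `d` being replaced by the matrix of `x ↦ d x`. -/
def realify {m κ : Type*} [Fintype m] [DecidableEq m] [Fintype κ] [DecidableEq κ]
    {D : Type*} [Ring D] [Algebra ℝ D] (b : Module.Basis κ ℝ D) :
    (Matrix m m D)ˣ →* GL (m × κ) ℝ :=
  Units.map ((Matrix.compRingEquiv m κ ℝ).toRingHom.comp
    (Algebra.leftMulMatrix b).toRingHom.mapMatrix).toMonoidHom

/-- `SU(p, q)`, as a group of real matrices through `ℂ = ℝ²`. -/
def suPQ (p q : ℕ) : Subgroup (GL ((Fin p ⊕ Fin q) × Fin 2) ℝ) :=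
  (indefiniteUnitary ℂ p q ⊓ Matrix.GeneralLinearGroup.det.ker).map
    (realify Complex.basisOneI)

/-- The basis `1, i, j, k` of the quaternions. -/
def quaternionBasis : Module.Basis (Fin 4) ℝ ℍ[ℝ] :=
  QuaternionAlgebra.basisOneIJK (-1) 0 (-1)

/-- `Sp(p, q)`, the quaternionic unitary group of signature `(p, q)`, as a group of real
matrices through `ℍ = ℝ⁴`. -/
def spPQ (p q : ℕ) : Subgroup (GL ((Fin p ⊕ Fin q) × Fin 4) ℝ) :=
  (indefiniteUnitary ℍ[ℝ] p q).map (realify quaternionBasis)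

/-- For all choices of maximal abelian subspaces and positive systems, the crown of `G` embeds
into the crown of the general linear group, and the domain `Λ` of `G` is bounded. -/
def EmbedsWithBoundedLambda (G : Subgroup (GL ι ℝ)) : Prop :=
  (∀ 𝔞 𝔟, IsMaximalAbelian G 𝔞 → IsMaximalAbelian (⊤ : Subgroup (GL ι ℝ)) 𝔟 →
    CrownEmbeds G 𝔞 𝔟) ∧
  ∀ 𝔞 Φ, IsMaximalAbelian G 𝔞 → IsPositiveSystem G 𝔞 Φ → IsBoundedSet (Lambda G 𝔞 Φ)

end Crown

end

/-! Write `z = a * aᵀ` for the point `a · z₀`, which depends only on the coset modulo the complex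
orthogonal group. If `exp(iY) · z₀ = g exp(iX) · z₀`, then `exp(iY) exp(iY)ᵀ = g exp(2iX) gᵀ`. When
the eigenvalues of `X` differ by less than `π/2`, some phase `e^{-iφ}` turns all eigenvalues of
`exp(2iX)` into the right half plane, so `e^{-iφ} exp(iY) exp(iY)ᵀ` has positive definite real part
(`exists_posDef_re_of_hasSmallSpread`).

Put `E = e^{-iφ/2} exp(iY) = P + iQ` with `P`, `Q` real. Positivity reads `P Pᵀ - Q Qᵀ > 0`, so `P`
is invertible and `R = P⁻¹ Q` is a contraction. Since `Y` is real, the conjugate of `E` is `E⁻¹`;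
hence `exp(2iY)` is, up to a phase, the Cayley transform `(1 + iR)(1 - iR)⁻¹`. Nilpotency of `Y`
gives `|det(1 - iR)| ≥ 1`, so `exp(2iY)` stays in a compact set (`exists_cayley_of_posDef`). The
logarithm of a unipotent matrix is polynomial, so `Y` is bounded by a constant depending only on the
size (`exists_bound_of_mem_crown`). This bounds the whole set of which `Λ` is a component.

It remains to see that `Ω` consists of matrices of small spread. This holds when every nonzero
difference `μ - ν` of weights of `𝔞` on the standard representation is a root
(`hasSmallSpread_of_weights`). A root vector is built from weight vectors `v`, `w`: the tensor `v
wᵀ` for `GL` and `SL`, and its symmetrized or skew-hermitian version, twisted by the invariant form,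
for the symplectic and unitary groups. Small spread also yields the embedding of crowns, because an
orthogonal matrix carries `X` into any prescribed maximal abelian subspace
(`smul_basePoint_mem_crown_top`). -/

open scoped Matrix Quaternion

noncomputable section

namespace Crown

/-! ### Exponentials and logarithms of nilpotent matrices; differentiation of `exp(tA)` at `0`. -/

section General
variable {n : Type*} [Fintype n] [DecidableEq n] {𝕜 : Type*} [RCLike 𝕜]

open NormedSpace

/-- A matrix that strictly lowers a real height function on the indices is nilpotent. -/
theorem isNilpotent_of_strict_order {R : Type*} [Semiring R] (d : n → ℝ) (M : Matrix n n R)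
    (h : ∀ i j, M i j ≠ 0 → d j < d i) : IsNilpotent M := by
  have key : ∀ k i j, (M ^ k) i j ≠ 0 → k ≤ (Finset.univ.filter fun l => d l < d i).card := by
    intro k
    induction k with
    | zero => intros; exact Nat.zero_le _
    | succ k ih =>
      intro i j hij
      rw [pow_succ', Matrix.mul_apply] at hij
      obtain ⟨l, -, hl⟩ := Finset.exists_ne_zero_of_sum_ne_zero hij
      have h1 := h i l (left_ne_zero_of_mul hl)
      have h2 := ih l j (right_ne_zero_of_mul hl)
      refine Nat.succ_le_of_lt (lt_of_le_of_lt h2 (Finset.card_lt_card ?_))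
      refine Finset.ssubset_iff_subset_ne.2 ⟨?_, ?_⟩
      · intro x hx
        simp only [Finset.mem_filter, Finset.mem_univ, true_and] at hx ⊢
        exact hx.trans h1
      · intro he
        have : l ∈ Finset.univ.filter fun x => d x < d i := by simp [h1]
        rw [← he] at this
        simp at this
  refine ⟨Fintype.card n + 1, ?_⟩
  ext i j
  by_contra hne
  have := (key _ i j hne).trans (Finset.card_le_univ _)
  omega

theorem exp_eq_sum_of_pow_eq_zero (N : Matrix n n 𝕜) {K : ℕ} (h : N ^ K = 0) :
    exp N = ∑ k ∈ Finset.range K, ((k.factorial : 𝕜)⁻¹) • N ^ k := by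
  rw [exp_eq_tsum 𝕜]
  refine tsum_eq_sum fun k hk => ?_
  rw [pow_eq_zero_of_le (by simpa using hk) h, smul_zero]

theorem isNilpotent_exp_sub_one {N : Matrix n n 𝕜} (h : IsNilpotent N) :
    IsNilpotent (exp N - 1) := by
  obtain ⟨K, hK⟩ := h
  have hK' : N ^ (K + 1) = 0 := by rw [pow_succ, hK, zero_mul]
  have : exp N - 1 = N * ∑ k ∈ Finset.range K, (((k + 1).factorial : 𝕜)⁻¹) • N ^ k := by
    rw [exp_eq_sum_of_pow_eq_zero N hK', Finset.sum_range_succ', Finset.mul_sum]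
    simp [pow_succ']
  rw [this]
  refine Commute.isNilpotent_mul_right ?_ ⟨K, hK⟩
  exact Commute.sum_right _ _ _ fun k _ => ((Commute.refl N).pow_right k).smul_right _

theorem det_smul_one_sub_of_isNilpotent {N : Matrix n n 𝕜} (h : IsNilpotent N) (a : 𝕜) :
    (a • (1 : Matrix n n 𝕜) - N).det = a ^ Fintype.card n := by
  have := (Matrix.isNilpotent_charpoly_sub_pow_of_isNilpotent h).eq_zero
  rw [sub_eq_zero] at this
  have h2 := congrArg (Polynomial.eval a) this
  rw [Matrix.eval_charpoly] at h2
  simpa [Matrix.smul_one_eq_diagonal] using h2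

/-- The matrix is the scalar `a + b` plus the nilpotent `a (exp N - 1)`. This later computes `det
P`. -/
theorem det_smul_exp_add_smul_one {N : Matrix n n 𝕜} (h : IsNilpotent N) (a b : 𝕜) :
    (a • exp N + b • (1 : Matrix n n 𝕜)).det = (a + b) ^ Fintype.card n := by
  rw [← det_smul_one_sub_of_isNilpotent
    ((isNilpotent_exp_sub_one h).smul (-a)) (a + b)]
  congr 1
  module

theorem det_exp_of_isNilpotent {N : Matrix n n 𝕜} (h : IsNilpotent N) : (exp N).det = 1 := by
  simpa using det_smul_exp_add_smul_one h 1 0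

/-- On polynomials of degree below `K`, the functional `f ↦ f'(0)` is a combination of the values at
`0, ..., K - 1`. -/
theorem exists_vandermonde_coeff (𝕜 : Type*) [RCLike 𝕜] (K : ℕ) :
    ∃ c : Fin K → 𝕜, ∀ j : Fin K, ∑ k : Fin K, c k * (k : 𝕜) ^ (j : ℕ) = if (j : ℕ) = 1 then 1 else 0 := by
  let V := Matrix.vandermonde (fun k : Fin K => ((k : ℕ) : 𝕜))
  have hV : IsUnit V.det := by
    rw [isUnit_iff_ne_zero, Matrix.det_vandermonde_ne_zero_iff]
    intro a b h
    exact Fin.ext (Nat.cast_injective (R := 𝕜) h)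
  refine ⟨(fun j : Fin K => if (j : ℕ) = 1 then (1 : 𝕜) else 0) ᵥ* V⁻¹, fun j => ?_⟩
  have h := Matrix.vecMul_vecMul (fun j : Fin K => if (j : ℕ) = 1 then (1 : 𝕜) else 0) V⁻¹ V
  rw [Matrix.nonsing_inv_mul V hV, Matrix.vecMul_one] at h
  exact congrFun h j

/-- A logarithm for unipotent matrices by interpolation of `t ↦ exp (t A)` at the integers. -/
theorem exists_log_coeff (𝕜 : Type*) [RCLike 𝕜] (K : ℕ) (hK : 2 ≤ K) :
    ∃ c : Fin K → 𝕜, ∀ A : Matrix n n 𝕜, A ^ K = 0 → A = ∑ k : Fin K, c k • exp A ^ (k : ℕ) := by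
  obtain ⟨c, hc⟩ := exists_vandermonde_coeff 𝕜 K
  refine ⟨c, fun A hA => ?_⟩
  have h1 : ∀ k : Fin K, exp A ^ (k : ℕ) =
      ∑ j : Fin K, (((j : ℕ).factorial : 𝕜)⁻¹ * ((k : ℕ) : 𝕜) ^ (j : ℕ)) • A ^ (j : ℕ) := by
    intro k
    rw [← Matrix.exp_nsmul, exp_eq_sum_of_pow_eq_zero ((k : ℕ) • A) (K := K)
      (by rw [smul_pow, hA, smul_zero]), Finset.sum_range]
    refine Finset.sum_congr rfl fun j _ => ?_
    rw [smul_pow, mul_smul, ← Nat.cast_smul_eq_nsmul 𝕜 (((k : ℕ)) ^ (j : ℕ)), Nat.cast_pow]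
  simp_rw [h1, Finset.smul_sum]
  rw [Finset.sum_comm]
  have h2 : ∀ j : Fin K, ∑ k : Fin K, c k • (((j : ℕ).factorial : 𝕜)⁻¹ * ((k : ℕ) : 𝕜) ^ (j : ℕ)) • A ^ (j : ℕ)
      = if (j : ℕ) = 1 then A else 0 := by
    intro j
    have : ∀ k : Fin K, c k • (((j : ℕ).factorial : 𝕜)⁻¹ * ((k : ℕ) : 𝕜) ^ (j : ℕ)) • A ^ (j : ℕ) =
        (c k * ((k : ℕ) : 𝕜) ^ (j : ℕ)) • (((j : ℕ).factorial : 𝕜)⁻¹ • A ^ (j : ℕ)) := by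
      intro k
      simp only [smul_smul]
      congr 1
      ring
    simp_rw [this, ← Finset.sum_smul, hc]
    split_ifs with h
    · simp [h]
    · simp
  simp_rw [h2]
  rw [Finset.sum_eq_single (⟨1, hK⟩ : Fin K)]
  · simp
  · intro j _ hj
    rw [if_neg]
    intro h
    exact hj (Fin.ext h)
  · simp

theorem hasDerivAt_exp_smul_zero (A : Matrix n n ℝ) (i j : n) :
    HasDerivAt (fun t : ℝ => exp (t • A) i j) (A i j) 0 := by
  have h : HasDerivAt (fun t : ℝ => exp (t • A)) A 0 := by
    open scoped Matrix.Norms.Operator in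
    simpa using! hasDerivAt_exp_smul_const A (0 : ℝ)
  exact hasDerivAt_pi.1 (hasDerivAt_pi.1 h i) j

theorem exp_mul_of_mul_eq {A B C : Matrix n n 𝕜} (h : A * B = B * C) :
    exp A * B = B * exp C := by
  open scoped Matrix.Norms.Operator in
  exact (SemiconjBy.exp_right (x := B) (a := C) (b := A) h.symm).symm

theorem mul_eq_of_exp_smul_mul {A B C : Matrix n n ℝ}
    (h : ∀ t : ℝ, exp (t • A) * B = B * exp (t • C)) : A * B = B * C := by
  ext i j
  have h1 : HasDerivAt (fun t : ℝ => (exp (t • A) * B) i j) ((A * B) i j) 0 := by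
    simp only [Matrix.mul_apply]
    exact HasDerivAt.fun_sum fun k _ => (hasDerivAt_exp_smul_zero A i k).mul_const _
  have h2 : HasDerivAt (fun t : ℝ => (B * exp (t • C)) i j) ((B * C) i j) 0 := by
    simp only [Matrix.mul_apply]
    exact HasDerivAt.fun_sum fun k _ => (hasDerivAt_exp_smul_zero C k j).const_mul _
  simp_rw [h] at h1
  exact h1.unique h2

/-- `A` is the limit at `0` of difference quotients of `exp(tA)`, which lie in the closed subspace
`L`. -/
theorem mem_of_exp_smul_mem (L : Submodule ℝ (Matrix n n ℝ)) {A : Matrix n n ℝ}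
    (h : ∀ t : ℝ, exp (t • A) ∈ L) : A ∈ L := by
  have hd : HasDerivAt (fun t : ℝ => exp (t • A)) A 0 := by
    open scoped Matrix.Norms.Operator in
    simpa using! hasDerivAt_exp_smul_const A (0 : ℝ)
  have hcl : IsClosed (L : Set (Matrix n n ℝ)) := by
    open scoped Matrix.Norms.Operator in
    exact L.closed_of_finiteDimensional
  open scoped Matrix.Norms.Operator in
  refine hcl.mem_of_tendsto hd.tendsto_slope (Filter.Eventually.of_forall fun t => ?_)
  rw [slope_def_module]
  exact L.smul_mem _ (L.sub_mem (h _) (h _))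

end General

/-! ### Simultaneous diagonalization, weights and roots. -/

section Diag
variable {ι : Type*} [Fintype ι] [DecidableEq ι]

theorem exists_orthonormalBasis_joint (𝔞 : Submodule ℝ (Matrix ι ι ℝ))
    (hs : ∀ X ∈ 𝔞, X.IsSymm) (hc : ∀ X ∈ 𝔞, ∀ Y ∈ 𝔞, X * Y = Y * X) :
    ∃ b : OrthonormalBasis ι ℝ (EuclideanSpace ℝ ι), ∀ i, ∀ H : 𝔞, ∃ c : ℝ,
      Matrix.toEuclideanLin (H : Matrix ι ι ℝ) (b i) = c • b i := by
  classical
  let T : 𝔞 → (EuclideanSpace ℝ ι →ₗ[ℝ] EuclideanSpace ℝ ι) :=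
    fun H => Matrix.toEuclideanLin (H : Matrix ι ι ℝ)
  have hT : ∀ H, (T H).IsSymmetric := fun H =>
    Matrix.isSymmetric_toEuclideanLin_iff.2 (by
      have := hs _ H.2
      rwa [Matrix.IsHermitian, Matrix.conjTranspose_eq_transpose_of_trivial])
  have hC : Pairwise (Function.onFun Commute T) := by
    intro A B _
    have := hc _ A.2 _ B.2
    change T A * T B = T B * T A
    simp only [T, Matrix.toEuclideanLin_eq_toLin_orthonormal]
    change Matrix.toLin _ _ _ ∘ₗ Matrix.toLin _ _ _ = Matrix.toLin _ _ _ ∘ₗ Matrix.toLin _ _ _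
    rw [← Matrix.toLin_mul, ← Matrix.toLin_mul, this]
  have hI := LinearMap.IsSymmetric.directSum_isInternal_of_pairwise_commute hT hC
  have hO := LinearMap.IsSymmetric.orthogonalFamily_iInf_eigenspaces hT
  -- The joint eigenspaces are indexed by all functions `𝔞 → ℝ`; an adapted orthonormal basis needs
  -- the finite subfamily of nonzero ones.
  have hfin := WellFoundedGT.finite_ne_bot_of_iSupIndep hI.submodule_iSupIndep
  have : Fintype {χ : 𝔞 → ℝ // (⨅ j, Module.End.eigenspace (T j) (χ j)) ≠ ⊥} := hfin.fintype
  have hI' := DirectSum.isInternal_ne_bot_iff.2 hI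
  have hO' := hO.comp (Subtype.val_injective
    (p := fun χ : 𝔞 → ℝ => (⨅ j, Module.End.eigenspace (T j) (χ j)) ≠ ⊥))
  have hn : Module.finrank ℝ (EuclideanSpace ℝ ι) = Fintype.card ι := finrank_euclideanSpace
  refine ⟨(hI'.subordinateOrthonormalBasis hn hO').reindex (Fintype.equivFin ι).symm, ?_⟩
  intro i H
  rw [OrthonormalBasis.reindex_apply]
  have := hI'.subordinateOrthonormalBasis_subordinate hn ((Fintype.equivFin ι).symm.symm i) hO'
  rw [Submodule.mem_iInf] at this
  exact ⟨_, Module.End.mem_eigenspace_iff.1 (this H)⟩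

/-- Simultaneous orthogonal diagonalization of a commuting space of symmetric matrices. -/
theorem exists_simultaneous_diagonalization (𝔞 : Submodule ℝ (Matrix ι ι ℝ))
    (hs : ∀ X ∈ 𝔞, X.IsSymm) (hc : ∀ X ∈ 𝔞, ∀ Y ∈ 𝔞, X * Y = Y * X) :
    ∃ (U : Matrix ι ι ℝ) (μ : ι → Module.Dual ℝ 𝔞), Uᵀ * U = 1 ∧ U * Uᵀ = 1 ∧
      ∀ H : 𝔞, (H : Matrix ι ι ℝ) = U * Matrix.diagonal (fun i => μ i H) * Uᵀ := by
  obtain ⟨b, hb⟩ := exists_orthonormalBasis_joint 𝔞 hs hc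
  choose χ hχ using hb
  let U : Matrix ι ι ℝ := Matrix.of fun i a => b a i
  have hU : Uᵀ * U = 1 := by
    ext i j
    have := b.inner_eq_ite i j
    rw [PiLp.inner_apply] at this
    simp only [Matrix.mul_apply, U, Matrix.transpose_apply, Matrix.of_apply, Matrix.one_apply]
    rw [← this]
    refine Finset.sum_congr rfl fun k _ => ?_
    simp [mul_comm]
  have hU' : U * Uᵀ = 1 := mul_eq_one_comm.1 hU
  have hHU : ∀ H : 𝔞, (H : Matrix ι ι ℝ) * U = U * Matrix.diagonal fun i => χ i H := by
    intro H
    ext i a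
    have := congrArg (fun v : EuclideanSpace ℝ ι => v i) (hχ a H)
    simp only [Matrix.mul_diagonal]
    simpa [Matrix.mul_apply, Matrix.mulVec, dotProduct, U, mul_comm] using this
  have hD : ∀ H : 𝔞, Uᵀ * (H : Matrix ι ι ℝ) * U = Matrix.diagonal fun i => χ i H := by
    intro H
    rw [Matrix.mul_assoc, hHU, ← Matrix.mul_assoc, hU, Matrix.one_mul]
  -- The chosen eigenvalues `χ i` are mere functions of `H`; reading them off as diagonal entries
  -- makes linearity visible.
  let μ : ι → Module.Dual ℝ 𝔞 := fun i =>
    { toFun := fun H => (Uᵀ * (H : Matrix ι ι ℝ) * U) i i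
      map_add' := by intro A B; simp [Matrix.mul_add, Matrix.add_mul]
      map_smul' := by intro r A; simp }
  refine ⟨U, μ, hU, hU', fun H => ?_⟩
  have : (fun i => μ i H) = fun i => χ i H := by
    ext i
    simp only [μ, LinearMap.coe_mk, AddHom.coe_mk, hD, Matrix.diagonal_apply_eq]
  rw [this, ← hHU, Matrix.mul_assoc, hU', Matrix.mul_one]

/-- The matrix is orthogonally diagonalizable with eigenvalues that differ by less than `π/2`. -/
def HasSmallSpread (X : Matrix ι ι ℝ) : Prop :=
  ∃ (U : Matrix ι ι ℝ) (d : ι → ℝ), Uᵀ * U = 1 ∧ U * Uᵀ = 1 ∧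
    X = U * Matrix.diagonal d * Uᵀ ∧ ∀ i j, d i - d j < Real.pi / 2

/-- In an eigenbasis, the bracket with a diagonal matrix scales the entry `(i, j)` by `d i - d j`. A
nonzero entry of an eigenvector thus forces `c = d i - d j`. -/
theorem conj_bracket_apply {U : Matrix ι ι ℝ} (hU : Uᵀ * U = 1) (d : ι → ℝ)
    {M : Matrix ι ι ℝ} {c : ℝ}
    (h : (U * Matrix.diagonal d * Uᵀ) * M - M * (U * Matrix.diagonal d * Uᵀ) = c • M) (i j : ι) :
    (d i - d j) * (Uᵀ * M * U) i j = c * (Uᵀ * M * U) i j := by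
  have h1 : Matrix.diagonal d * (Uᵀ * M * U) - (Uᵀ * M * U) * Matrix.diagonal d
      = c • (Uᵀ * M * U) := by
    have := congrArg (fun N => Uᵀ * N * U) h
    simp only [Matrix.mul_sub, Matrix.sub_mul, Matrix.mul_smul, Matrix.smul_mul] at this
    rw [← this]
    congr 1
    · calc _ = 1 * Matrix.diagonal d * (Uᵀ * M * U) := by rw [Matrix.one_mul]
        _ = _ := by rw [← hU]; simp only [Matrix.mul_assoc]
    · calc _ = (Uᵀ * M * U) * Matrix.diagonal d * 1 := by rw [Matrix.mul_one]
        _ = _ := by rw [← hU]; simp only [Matrix.mul_assoc]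
  have h2 := congrFun (congrFun h1 i) j
  rw [Matrix.sub_apply, Matrix.diagonal_mul, Matrix.mul_diagonal, Matrix.smul_apply,
    smul_eq_mul] at h2
  linarith

theorem conj_ne_zero {U : Matrix ι ι ℝ} (hU' : U * Uᵀ = 1) {M : Matrix ι ι ℝ} (hM : M ≠ 0) :
    Uᵀ * M * U ≠ 0 := by
  intro h
  apply hM
  calc M = (U * Uᵀ) * M * (U * Uᵀ) := by rw [hU', Matrix.one_mul, Matrix.mul_one]
    _ = U * (Uᵀ * M * U) * Uᵀ := by simp only [Matrix.mul_assoc]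
    _ = 0 := by rw [h, Matrix.mul_zero, Matrix.zero_mul]

theorem isNilpotent_of_conj {U : Matrix ι ι ℝ} (hU' : U * Uᵀ = 1) {M : Matrix ι ι ℝ}
    (h : IsNilpotent (Uᵀ * M * U)) : IsNilpotent M := by
  obtain ⟨k, hk⟩ := h
  have hp : ∀ k, (Uᵀ * M * U) ^ k = Uᵀ * M ^ k * U := by
    have hU : Uᵀ * U = 1 := mul_eq_one_comm.1 hU'
    intro k
    induction k with
    | zero => simp [hU]
    | succ k ih =>
      rw [pow_succ, ih, pow_succ]
      calc _ = Uᵀ * M ^ k * (U * Uᵀ) * M * U := by simp only [Matrix.mul_assoc]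
        _ = _ := by rw [hU', Matrix.mul_one]; simp only [Matrix.mul_assoc]
  refine ⟨k, ?_⟩
  by_contra hne
  exact conj_ne_zero hU' hne (by rw [← hp, hk])

variable {G : Subgroup (GL ι ℝ)} {𝔞 : Submodule ℝ (Matrix ι ι ℝ)}

theorem isNilpotent_of_bracket (h𝔞 : IsAbelianInS G 𝔞) {α : Module.Dual ℝ 𝔞} (hα : α ≠ 0)
    {M : Matrix ι ι ℝ} (hM : ∀ H : 𝔞, (H : Matrix ι ι ℝ) * M - M * (H : Matrix ι ι ℝ) = α H • M) :
    IsNilpotent M := by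
  obtain ⟨U, μ, hU, hU', hμ⟩ :=
    exists_simultaneous_diagonalization 𝔞 (fun X hX => (h𝔞.1 X hX).2) h𝔞.2
  obtain ⟨H, hH⟩ : ∃ H, 0 < α H := by
    obtain ⟨H, hH⟩ : ∃ H, α H ≠ 0 := by
      by_contra! h
      exact hα (LinearMap.ext h)
    rcases lt_or_gt_of_ne hH with h | h
    · exact ⟨-H, by simpa using h⟩
    · exact ⟨H, h⟩
  refine isNilpotent_of_conj hU' (isNilpotent_of_strict_order (fun i => μ i H) _ fun i j hij => ?_)
  have h1 := hM H
  rw [hμ H] at h1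
  have := mul_right_cancel₀ hij (conj_bracket_apply hU _ h1 i j)
  linarith

/-- The regular element defining `Φ` orders the weights so that all positive root vectors are
strictly triangular at once, a condition stable under linear combinations. -/
theorem isNilpotent_of_mem_nilradical (h𝔞 : IsAbelianInS G 𝔞) {Φ : Set (Module.Dual ℝ 𝔞)}
    (hΦ : IsPositiveSystem G 𝔞 Φ) {Y : Matrix ι ι ℝ} (hY : Y ∈ nilradical G 𝔞 Φ) :
    IsNilpotent Y := by
  obtain ⟨U, μ, hU, hU', hμ⟩ :=
    exists_simultaneous_diagonalization 𝔞 (fun X hX => (h𝔞.1 X hX).2) h𝔞.2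
  obtain ⟨H, -, rfl⟩ := hΦ
  refine isNilpotent_of_conj hU' (isNilpotent_of_strict_order (fun i => μ i H) _ ?_)
  unfold nilradical at hY
  induction hY using Submodule.span_induction with
  | mem M hM =>
    intro i j hij
    simp only [Set.mem_iUnion] at hM
    obtain ⟨α, ⟨-, hα⟩, -, hM⟩ := hM
    have h1 := hM H
    rw [hμ H] at h1
    have := mul_right_cancel₀ hij (conj_bracket_apply hU _ h1 i j)
    linarith
  | zero => intro i j hij; simp at hij
  | add A B _ _ hA hB =>
    intro i j hij
    rw [Matrix.mul_add, Matrix.add_mul, Matrix.add_apply] at hij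
    by_cases h : (Uᵀ * A * U) i j = 0
    · refine hB i j fun h' => hij (by rw [h, h', add_zero])
    · exact hA i j h
  | smul r A _ hA =>
    intro i j hij
    refine hA i j fun h => hij ?_
    simp [h]

theorem lt_of_mem_Omega {X : Matrix ι ι ℝ} (hX : X ∈ Omega G 𝔞) (hX' : X ∈ 𝔞)
    (α : Module.Dual ℝ 𝔞)
    (h : α ≠ 0 → ∃ M ∈ rootSpace G 𝔞 α, M ≠ 0) : α ⟨X, hX'⟩ < Real.pi / 2 := by
  by_cases hα : α = 0
  · rw [hα, LinearMap.zero_apply]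
    positivity
  · obtain ⟨_, hX⟩ := hX
    exact hX α ⟨hα, h hα⟩

/-- The elements of `Ω` have small spread if all the nonzero differences of weights of `𝔞` on the
standard representation are roots. -/
theorem hasSmallSpread_of_weights (h𝔞 : IsAbelianInS G 𝔞)
    (hroot : ∀ (v w : ι → ℝ) (μ ν : Module.Dual ℝ 𝔞), v ≠ 0 → w ≠ 0 →
      (∀ H : 𝔞, (H : Matrix ι ι ℝ) *ᵥ v = μ H • v) →
      (∀ H : 𝔞, (H : Matrix ι ι ℝ) *ᵥ w = ν H • w) → μ - ν ≠ 0 →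
      ∃ M ∈ rootSpace G 𝔞 (μ - ν), M ≠ 0)
    {X : Matrix ι ι ℝ} (hX : X ∈ Omega G 𝔞) : HasSmallSpread X := by
  obtain ⟨U, μ, hU, hU', hμ⟩ :=
    exists_simultaneous_diagonalization 𝔞 (fun X hX => (h𝔞.1 X hX).2) h𝔞.2
  have hX' : X ∈ 𝔞 := hX.1
  have hcol : ∀ i, U *ᵥ Pi.single i 1 ≠ 0 := by
    intro i h
    have h1 : Uᵀ *ᵥ (U *ᵥ Pi.single i 1) = Pi.single i 1 := by
      rw [Matrix.mulVec_mulVec, hU, Matrix.one_mulVec]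
    rw [h, Matrix.mulVec_zero] at h1
    simpa using congrFun h1 i
  have hweight : ∀ i, ∀ H : 𝔞, (H : Matrix ι ι ℝ) *ᵥ (U *ᵥ Pi.single i 1) =
      μ i H • (U *ᵥ Pi.single i 1) := by
    intro i H
    rw [hμ H, Matrix.mulVec_mulVec, Matrix.mul_assoc, hU, Matrix.mul_one, ← Matrix.mulVec_mulVec,
      ← Matrix.mulVec_smul]
    congr 1
    ext j
    rw [Matrix.mulVec_diagonal]
    by_cases h : j = i
    · subst h; simp
    · simp [h]
  refine ⟨U, fun i => μ i ⟨X, hX'⟩, hU, hU', hμ ⟨X, hX'⟩, fun i j => ?_⟩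
  exact lt_of_mem_Omega hX hX' (μ i - μ j)
    (hroot _ _ _ _ (hcol i) (hcol j) (hweight i) (hweight j))

/-- If `𝔤` contains all the nilpotent matrices, then the elements of `Ω` have small spread. -/
theorem hasSmallSpread_of_nilpotent_mem (h𝔞 : IsAbelianInS G 𝔞)
    (hG : ∀ M : Matrix ι ι ℝ, IsNilpotent M → M ∈ lieAlg G)
    {X : Matrix ι ι ℝ} (hX : X ∈ Omega G 𝔞) : HasSmallSpread X := by
  refine hasSmallSpread_of_weights h𝔞 (fun v w μ ν hv hw hvμ hwν hne => ?_) hX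
  -- As `H` is symmetric, `v wᵀ` is an eigenvector of the bracket with eigenvalue `μ - ν`. For `μ ≠
  -- ν` this makes it nilpotent, hence an element of `𝔤`.
  have hM : ∀ H : 𝔞, (H : Matrix ι ι ℝ) * Matrix.vecMulVec v w -
      Matrix.vecMulVec v w * (H : Matrix ι ι ℝ) = (μ - ν) H • Matrix.vecMulVec v w := by
    intro H
    rw [Matrix.mul_vecMulVec, Matrix.vecMulVec_mul, ← Matrix.mulVec_transpose,
      (h𝔞.1 H H.2).2.eq, hvμ, hwν, Matrix.smul_vecMulVec, Matrix.vecMulVec_smul, ← sub_smul]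
    rfl
  refine ⟨_, ⟨hG _ (isNilpotent_of_bracket h𝔞 hne hM), hM⟩, fun h => ?_⟩
  obtain ⟨i, hi⟩ := Function.ne_iff.1 hv
  obtain ⟨j, hj⟩ := Function.ne_iff.1 hw
  exact mul_ne_zero hi hj (congrFun (congrFun h i) j)

end Diag

/-! ### The uniform bound on `Y` through the Cayley transform. -/

section Bound
variable {ι : Type*} [Fintype ι] [DecidableEq ι]

open NormedSpace Complex

/-- The inclusion of real matrices into complex matrices. -/
def cplx : Matrix ι ι ℝ →+* Matrix ι ι ℂ := Complex.ofRealHom.mapMatrix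

@[simp] theorem cplx_apply (X : Matrix ι ι ℝ) (i j : ι) : cplx X i j = (X i j : ℂ) := rfl

theorem cplx_transpose (X : Matrix ι ι ℝ) : cplx Xᵀ = (cplx X)ᵀ := rfl

theorem cplx_diagonal (d : ι → ℝ) :
    cplx (Matrix.diagonal d) = Matrix.diagonal fun i => (d i : ℂ) := by
  ext i j
  by_cases h : i = j
  · subst h; simp
  · simp [h]

theorem coe_expI (X : Matrix ι ι ℝ) : (expI X : Matrix ι ι ℂ) = exp (I • cplx X) := rfl

theorem coe_toComplex (g : GL ι ℝ) :
    (toComplex g : Matrix ι ι ℂ) = cplx (g : Matrix ι ι ℝ) := rfl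

theorem coe_expGL {𝕜 : Type*} [RCLike 𝕜] (X : Matrix ι ι 𝕜) :
    (expGL X : Matrix ι ι 𝕜) = exp X := rfl

theorem exp_I_smul_cplx_conj {W : Matrix ι ι ℝ} (hW : Wᵀ * W = 1) (X : Matrix ι ι ℝ) :
    exp (I • cplx (W * X * Wᵀ)) = cplx W * exp (I • cplx X) * cplx Wᵀ := by
  have hW' : W * Wᵀ = 1 := mul_eq_one_comm.1 hW
  have h : (I • cplx (W * X * Wᵀ)) * cplx W = cplx W * (I • cplx X) := by
    rw [Matrix.smul_mul, Matrix.mul_smul, ← map_mul, ← map_mul, Matrix.mul_assoc _ Wᵀ, hW,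
      Matrix.mul_one]
  rw [← exp_mul_of_mul_eq h, Matrix.mul_assoc _ (cplx W), ← map_mul, hW', map_one, Matrix.mul_one]

theorem exp_I_smul_cplx_diagonal (d : ι → ℝ) :
    exp (I • cplx (Matrix.diagonal d)) = Matrix.diagonal fun i => Complex.exp (I * d i) := by
  rw [cplx_diagonal, ← Matrix.diagonal_smul, Matrix.exp_diagonal, Complex.exp_eq_exp_ℂ]
  congr 1
  ext i
  rw [Pi.coe_exp]
  rfl

/-- After the rotation the real part is `B diag(cos(2 d i - φ)) Bᵀ` with `B = g U` real and
invertible. The phase depends on `X` alone, since congruence by a real matrix commutes with taking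
real parts. -/
theorem exists_posDef_re_of_hasSmallSpread {X : Matrix ι ι ℝ} (hX : HasSmallSpread X) :
    ∃ φ : ℝ, ∀ g : GL ι ℝ, ((Complex.exp (-(I * φ)) • (cplx (g : Matrix ι ι ℝ) *
      (exp (I • cplx X) * (exp (I • cplx X))ᵀ) *
        (cplx (g : Matrix ι ι ℝ))ᵀ)).map Complex.re).PosDef := by
  obtain ⟨U, d, hU, hU', rfl, hd⟩ := hX
  obtain ⟨φ, hφ⟩ : ∃ φ : ℝ, ∀ i, |2 * d i - φ| < Real.pi / 2 := by
    cases isEmpty_or_nonempty ι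
    · exact ⟨0, fun i => isEmptyElim i⟩
    · obtain ⟨a, ha⟩ := Finite.exists_min d
      obtain ⟨b, hb⟩ := Finite.exists_max d
      -- Smallest plus largest eigenvalue: the midpoint of the range of the `2 * d i`.
      refine ⟨d a + d b, fun i => ?_⟩
      rw [abs_lt]
      constructor <;> linarith [hd b a, ha i, hb i]
  refine ⟨φ, fun g => ?_⟩
  set B : Matrix ι ι ℝ := (g : Matrix ι ι ℝ) * U with hB
  have h1 : Complex.exp (-(I * φ)) • (cplx (g : Matrix ι ι ℝ) *
      (exp (I • cplx (U * Matrix.diagonal d * Uᵀ)) *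
        (exp (I • cplx (U * Matrix.diagonal d * Uᵀ)))ᵀ) * (cplx (g : Matrix ι ι ℝ))ᵀ) =
      cplx B * Matrix.diagonal (fun i => Complex.exp (I * ((2 * d i - φ : ℝ) : ℂ))) * cplx Bᵀ := by
    rw [exp_I_smul_cplx_conj hU, exp_I_smul_cplx_diagonal, Matrix.transpose_mul,
      Matrix.transpose_mul, ← cplx_transpose, ← cplx_transpose, Matrix.transpose_transpose,
      Matrix.diagonal_transpose]
    have e1 : Matrix.diagonal (fun i => Complex.exp (I * ((2 * d i - φ : ℝ) : ℂ))) =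
        Complex.exp (-(I * φ)) • (Matrix.diagonal (fun i => Complex.exp (I * d i)) *
          (cplx Uᵀ * cplx U) * Matrix.diagonal (fun i => Complex.exp (I * d i))) := by
      rw [← map_mul, hU, map_one, Matrix.mul_one, Matrix.diagonal_mul_diagonal,
        ← Matrix.diagonal_smul]
      congr 1
      ext i
      simp only [Pi.smul_apply, smul_eq_mul, ← Complex.exp_add]
      congr 1
      push_cast
      ring
    rw [e1, hB, Matrix.transpose_mul, map_mul, map_mul, ← cplx_transpose]
    simp only [Matrix.mul_smul, Matrix.smul_mul, Matrix.mul_assoc]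
  rw [h1]
  have h2 : (cplx B * Matrix.diagonal (fun i => Complex.exp (I * ((2 * d i - φ : ℝ) : ℂ))) *
      cplx Bᵀ).map Complex.re = B * Matrix.diagonal (fun i => Real.cos (2 * d i - φ)) * Bᴴ := by
    ext i j
    rw [Matrix.map_apply, Matrix.mul_apply, Matrix.mul_apply, Complex.re_sum,
      Matrix.conjTranspose_eq_transpose_of_trivial]
    refine Finset.sum_congr rfl fun k _ => ?_
    rw [Matrix.mul_diagonal, Matrix.mul_diagonal, cplx_apply, cplx_apply,
      Complex.re_mul_ofReal, Complex.re_ofReal_mul, mul_comm I, Complex.exp_ofReal_mul_I_re]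
  rw [h2]
  refine Matrix.PosDef.mul_mul_conjTranspose_same (Matrix.PosDef.diagonal fun i => ?_) ?_
  · exact Real.cos_pos_of_mem_Ioo ⟨by linarith [(abs_lt.1 (hφ i)).1], (abs_lt.1 (hφ i)).2⟩
  · rw [Matrix.vecMul_injective_iff_isUnit]
    exact g.isUnit.mul ⟨⟨U, Uᵀ, hU', hU⟩, rfl⟩

/-- The interpolated logarithm of the right-hand side is continuous in `(R, ε)` on a compact set.
The adjugate, with the reciprocal determinant absorbed in `ε`, keeps it continuous where `1 - iR` is
singular. -/
theorem exists_bound_of_cayley (ι : Type*) [Fintype ι] [DecidableEq ι] :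
    ∃ C : ℝ, ∀ (R Y : Matrix ι ι ℝ) (ε : ℂ), (∀ i j, |R i j| ≤ 1) → ‖ε‖ ≤ 1 → IsNilpotent Y →
      exp ((2 * I) • cplx Y) = ε • ((1 + I • cplx R) * (1 - I • cplx R).adjugate) →
      ∀ i j, |Y i j| ≤ C := by
  -- `Fintype.card ι` powers kill `Y` by Cayley–Hamilton; the extra `2` meets the requirement `2 ≤
  -- K` of `exists_log_coeff` in every size.
  set K := Fintype.card ι + 2
  obtain ⟨c, hc⟩ := exists_log_coeff (n := ι) ℂ K (by omega)
  let F : Matrix ι ι ℝ × ℂ → Matrix ι ι ℂ := fun p => ∑ k : Fin K,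
    c k • (p.2 • ((1 + I • cplx p.1) * (1 - I • cplx p.1).adjugate)) ^ (k : ℕ)
  have hcp : Continuous fun p : Matrix ι ι ℝ × ℂ => cplx p.1 := by
    refine continuous_matrix fun i j => ?_
    simp only [cplx_apply]
    exact Complex.continuous_ofReal.comp (continuous_fst.matrix_elem i j)
  have hF : Continuous F := by
    have h1 : Continuous fun p : Matrix ι ι ℝ × ℂ =>
        (1 + I • cplx p.1) * (1 - I • cplx p.1).adjugate :=
      (continuous_const.add (hcp.const_smul I)).mul
        (continuous_const.sub (hcp.const_smul I)).matrix_adjugate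
    have h2 : Continuous fun p : Matrix ι ι ℝ × ℂ =>
        p.2 • ((1 + I • cplx p.1) * (1 - I • cplx p.1).adjugate) := continuous_snd.smul h1
    exact continuous_finsetSum _ fun k _ => (h2.pow (k : ℕ)).const_smul (c k)
  let s : Set (Matrix ι ι ℝ × ℂ) :=
    (Set.pi Set.univ fun _ => Set.pi Set.univ fun _ => Set.Icc (-1 : ℝ) 1) ×ˢ
      Metric.closedBall (0 : ℂ) 1
  have hs : IsCompact s := (isCompact_univ_pi fun _ => isCompact_univ_pi fun _ =>
    isCompact_Icc).prod (isCompact_closedBall _ _)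
  obtain ⟨C, hC⟩ := hs.exists_bound_of_continuousOn
    (continuous_pi fun i => continuous_pi fun j => hF.matrix_elem i j).continuousOn
  refine ⟨C, fun R Y ε hR hε hY hexp i j => ?_⟩
  have hmem : (R, ε) ∈ s :=
    ⟨fun i _ j _ => abs_le.1 (hR i j), by simpa using hε⟩
  have hnil : ((2 * I) • cplx Y) ^ K = 0 := by
    have : Y ^ K = 0 := by
      have h := (Matrix.isNilpotent_charpoly_sub_pow_of_isNilpotent hY).eq_zero
      rw [sub_eq_zero] at h
      have h2 := Matrix.aeval_self_charpoly Y
      rw [h] at h2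
      simp only [map_pow, Polynomial.aeval_X] at h2
      exact pow_eq_zero_of_le (by omega) h2
    rw [smul_pow, ← map_pow, this, map_zero, smul_zero]
  have hval : (2 * I) * (Y i j : ℂ) = F (R, ε) i j := by
    have := hc _ hnil
    rw [hexp] at this
    exact congrFun (congrFun this i) j
  have h1 : ‖F (R, ε) i j‖ ≤ C :=
    ((norm_le_pi_norm (fun j => F (R, ε) i j) j).trans
      (norm_le_pi_norm (fun i j => F (R, ε) i j) i)).trans (hC _ hmem)
  rw [← hval] at h1
  simp only [norm_mul, Complex.norm_I, Complex.norm_real, mul_one, Real.norm_eq_abs] at h1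
  have : ‖(2 : ℂ)‖ = 2 := by simp
  rw [this] at h1
  linarith [abs_nonneg (Y i j)]

theorem map_conj_exp (A : Matrix ι ι ℂ) :
    (exp A).map (starRingEnd ℂ) = exp (A.map (starRingEnd ℂ)) := by
  have h : ∀ B : Matrix ι ι ℂ, B.map (starRingEnd ℂ) = Bᴴᵀ := fun _ => rfl
  rw [h, h, Matrix.exp_transpose, Matrix.exp_conjTranspose]

theorem exists_cayley_of_posDef {Y : Matrix ι ι ℝ} (hY : IsNilpotent Y) {φ : ℝ}
    (hφ : ((Complex.exp (-(I * φ)) • (exp (I • cplx Y) * (exp (I • cplx Y))ᵀ)).map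
      Complex.re).PosDef) :
    ∃ (R : Matrix ι ι ℝ) (ε : ℂ), (∀ i j, |R i j| ≤ 1) ∧ ‖ε‖ ≤ 1 ∧
      exp ((2 * I) • cplx Y) = ε • ((1 + I • cplx R) * (1 - I • cplx R).adjugate) := by
  -- Half the phase, because `E = ω u` enters quadratically in `E Eᵀ`.
  set ω : ℂ := Complex.exp (-(I * (φ / 2 : ℝ))) with hω
  set ω' : ℂ := Complex.exp (I * (φ / 2 : ℝ)) with hω'
  have hωω' : ω * ω' = 1 := by rw [hω, hω', ← Complex.exp_add]; simp
  have hωn : ‖ω‖ = 1 := by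
    rw [hω, ← mul_neg, mul_comm, ← Complex.ofReal_neg]; exact Complex.norm_exp_ofReal_mul_I _
  have hωn' : ‖ω'‖ = 1 := by
    rw [hω', mul_comm]; exact Complex.norm_exp_ofReal_mul_I _
  have hconjω : starRingEnd ℂ ω = ω' := by
    rw [hω, hω', ← Complex.exp_conj, map_neg, map_mul, Complex.conj_I, Complex.conj_ofReal,
      neg_mul, neg_neg]
  set u := exp (I • cplx Y) with hu
  set u' := exp (-(I • cplx Y)) with hu'
  have huu' : u * u' = 1 := by
    rw [hu, hu', ← Matrix.exp_add_of_commute _ _ (Commute.refl (I • cplx Y)).neg_right, add_neg_cancel,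
      NormedSpace.exp_zero]
  have hu'u : u' * u = 1 := mul_eq_one_comm.1 huu'
  have hconju : u.map (starRingEnd ℂ) = u' := by
    rw [hu, hu', map_conj_exp]
    congr 1
    ext i j
    simp
  set E := ω • u with hE
  set E' := ω' • u' with hE'
  set P := E.map Complex.re with hP
  set Q := E.map Complex.im with hQ
  have hEPQ : E = cplx P + I • cplx Q := by
    ext i j
    simp only [hP, hQ, Matrix.add_apply, cplx_apply, Matrix.smul_apply, Matrix.map_apply,
      smul_eq_mul]
    rw [mul_comm I]
    exact (Complex.re_add_im _).symm
  have hconjE : E.map (starRingEnd ℂ) = E' := by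
    rw [hE, hE', ← hconju, ← hconjω]
    ext i j
    simp
  have hEPQ' : E' = cplx P - I • cplx Q := by
    rw [← hconjE]
    conv_lhs => rw [hEPQ]
    ext i j
    simp [sub_eq_add_neg]
  have hEE' : E * E' = 1 := by
    rw [hE, hE', Matrix.smul_mul, Matrix.mul_smul, smul_smul, hωω', huu', one_smul]
  have hE'E : E' * E = 1 := mul_eq_one_comm.1 hEE'
  have hPE : cplx P = (2⁻¹ : ℂ) • (E + E') := by rw [hEPQ, hEPQ']; module
  have hQE : I • cplx Q = (2⁻¹ : ℂ) • (E - E') := by rw [hEPQ, hEPQ']; module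
  have hcinj : Function.Injective (cplx : Matrix ι ι ℝ → Matrix ι ι ℂ) := fun A B h => by
    ext i j
    exact Complex.ofReal_injective (congrFun (congrFun h i) j)
  -- Both are combinations of `E` and its inverse `E'`.
  have hcomm : P * Q = Q * P := by
    have h : cplx P * (I • cplx Q) = (I • cplx Q) * cplx P := by
      rw [hPE, hQE]
      simp only [Matrix.smul_mul, Matrix.mul_smul, Matrix.add_mul, Matrix.mul_add, Matrix.sub_mul,
        Matrix.mul_sub, hEE', hE'E]
      module
    rw [Matrix.mul_smul, Matrix.smul_mul] at h
    have h' := smul_right_injective _ Complex.I_ne_zero h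
    rw [← map_mul, ← map_mul] at h'
    exact hcinj h'
  have hW : (P * Pᵀ - Q * Qᵀ).PosDef := by
    convert hφ using 1
    have : Complex.exp (-(I * φ)) • (u * uᵀ) = E * Eᵀ := by
      rw [hE, Matrix.transpose_smul, Matrix.smul_mul, Matrix.mul_smul, smul_smul, hω,
        ← Complex.exp_add]
      congr 2
      push_cast
      ring
    rw [this]
    ext i j
    simp [Matrix.mul_apply, hP, hQ, Complex.re_sum, Finset.sum_sub_distrib]
  -- A row vector `x` with `x P = 0` would give the positive form the value `-|x Q|²`.
  have hPu : IsUnit P := by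
    rw [← Matrix.vecMul_injective_iff_isUnit]
    intro x y hxy
    by_contra hne
    have hz : x - y ≠ 0 := sub_ne_zero.2 hne
    have hz0 : (x - y) ᵥ* P = 0 := by
      have : x ᵥ* P = y ᵥ* P := hxy
      rw [Matrix.sub_vecMul, this, sub_self]
    have hpos := hW.dotProduct_mulVec_pos hz
    rw [star_trivial, Matrix.sub_mulVec, dotProduct_sub, ← Matrix.mulVec_mulVec,
      Matrix.dotProduct_mulVec _ P, hz0, zero_dotProduct, ← Matrix.mulVec_mulVec,
      Matrix.dotProduct_mulVec _ Q, Matrix.mulVec_transpose, zero_sub] at hpos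
    have : 0 ≤ ((x - y) ᵥ* Q) ⬝ᵥ ((x - y) ᵥ* Q) := Finset.sum_nonneg fun i _ => mul_self_nonneg _
    linarith
  have hPd : IsUnit P.det := (Matrix.isUnit_iff_isUnit_det _).1 hPu
  have hPinv : P * P⁻¹ = 1 := Matrix.mul_nonsing_inv P hPd
  have hPinv' : P⁻¹ * P = 1 := Matrix.nonsing_inv_mul P hPd
  set R := P⁻¹ * Q with hR
  have hRP : R * P = Q := by rw [hR, Matrix.mul_assoc, ← hcomm, ← Matrix.mul_assoc, hPinv',
    Matrix.one_mul]
  -- Congruence of `P Pᵀ - Q Qᵀ` by `P⁻¹`. The diagonal entries then bound each row of `R` by `1` in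
  -- Euclidean norm.
  have hRpos : (1 - R * Rᵀ).PosSemidef := by
    have h := hW.posSemidef.mul_mul_conjTranspose_same P⁻¹
    convert h using 1
    rw [Matrix.conjTranspose_eq_transpose_of_trivial, Matrix.mul_sub, Matrix.sub_mul]
    congr 1
    · rw [← Matrix.mul_assoc, hPinv', Matrix.one_mul, ← Matrix.transpose_mul, hPinv',
        Matrix.transpose_one]
    · rw [hR, Matrix.transpose_mul]
      simp only [Matrix.mul_assoc]
  have hRle : ∀ i j, |R i j| ≤ 1 := by
    intro i j
    have h := hRpos.diag_nonneg (i := i)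
    rw [Matrix.sub_apply, Matrix.one_apply_eq, Matrix.mul_apply] at h
    simp only [Matrix.transpose_apply] at h
    have h2 : R i j * R i j ≤ ∑ k, R i k * R i k :=
      Finset.single_le_sum (f := fun k => R i k * R i k) (fun k _ => mul_self_nonneg _)
        (Finset.mem_univ j)
    rw [abs_le_one_iff_mul_self_le_one]
    linarith
  have hE1 : E = (1 + I • cplx R) * cplx P := by
    rw [Matrix.add_mul, Matrix.one_mul, Matrix.smul_mul, ← map_mul, hRP, ← hEPQ]
  have hE2 : E' = (1 - I • cplx R) * cplx P := by
    rw [Matrix.sub_mul, Matrix.one_mul, Matrix.smul_mul, ← map_mul, hRP, ← hEPQ']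
  have hnil : ∀ z : ℂ, IsNilpotent (z • cplx Y) := fun z => (hY.map cplx).smul z
  have hu2 : u * u = exp ((2 * I) • cplx Y) := by
    rw [hu, ← Matrix.exp_add_of_commute _ _ (Commute.refl _)]
    congr 1
    module
  have hdetu : u.det = 1 := det_exp_of_isNilpotent (hnil I)
  have hdetu' : u'.det = 1 := det_exp_of_isNilpotent (hnil I).neg
  have hdetE' : ‖E'.det‖ = 1 := by
    rw [hE', Matrix.det_smul, hdetu', mul_one, norm_pow, hωn', one_pow]
  -- `P u = (ω exp(2iY) + ω') / 2` with `exp(2iY)` unipotent, so `det P` is a power of `(ω + ω') /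
  -- 2`. Together with `|det E'| = 1` this gives the lower bound on `det(1 - iR)`.
  have hdetP : ‖(cplx P).det‖ ≤ 1 := by
    have h : cplx P * u = (2⁻¹ * ω : ℂ) • exp ((2 * I) • cplx Y) + (2⁻¹ * ω' : ℂ) • 1 := by
      rw [hPE, hE, hE', ← hu2, Matrix.smul_mul, Matrix.add_mul, Matrix.smul_mul, Matrix.smul_mul,
        hu'u, smul_add, smul_smul, smul_smul]
    have h2 := congrArg Matrix.det h
    rw [Matrix.det_mul, hdetu, mul_one, det_smul_exp_add_smul_one (hnil _)] at h2
    rw [h2, norm_pow]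
    refine pow_le_one₀ (norm_nonneg _) ((norm_add_le _ _).trans ?_)
    rw [norm_mul, norm_mul, hωn, hωn']
    norm_num
  have hdet : (1 - I • cplx R).det * (cplx P).det = E'.det := by rw [hE2, Matrix.det_mul]
  set D := (1 - I • cplx R).det with hD
  have hDn : 1 ≤ ‖D‖ := by
    have h := congrArg norm hdet
    rw [norm_mul, hdetE'] at h
    nlinarith [norm_nonneg D, norm_nonneg (cplx P).det]
  have hD0 : D ≠ 0 := fun h => by rw [h, norm_zero] at hDn; linarith
  have hmain : exp ((2 * I) • cplx Y) * (1 - I • cplx R) = (ω' * ω') • (1 + I • cplx R) := by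
    have hPc : cplx P * cplx P⁻¹ = 1 := by rw [← map_mul, hPinv, map_one]
    have h : exp ((2 * I) • cplx Y) * E' = (ω' * ω') • E := by
      rw [← hu2, hE', hE, Matrix.mul_smul, Matrix.mul_assoc, huu', Matrix.mul_one, smul_smul]
      congr 1
      linear_combination (-ω') * hωω'
    calc exp ((2 * I) • cplx Y) * (1 - I • cplx R)
        = exp ((2 * I) • cplx Y) * ((1 - I • cplx R) * cplx P) * cplx P⁻¹ := by
          simp only [Matrix.mul_assoc, hPc, Matrix.mul_one]
      _ = (ω' * ω') • (((1 + I • cplx R) * cplx P) * cplx P⁻¹) := by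
          rw [← hE2, h, hE1, Matrix.smul_mul]
      _ = _ := by rw [Matrix.mul_assoc, hPc, Matrix.mul_one]
  refine ⟨R, D⁻¹ * (ω' * ω'), hRle, ?_, ?_⟩
  · rw [norm_mul, norm_mul, hωn', norm_inv, mul_one, mul_one]
    exact inv_le_one_of_one_le₀ hDn
  · rw [mul_smul D⁻¹ (ω' * ω'), ← Matrix.smul_mul, ← hmain, Matrix.mul_assoc, Matrix.mul_adjugate, ← hD,
      Matrix.mul_smul, Matrix.mul_one, smul_smul, inv_mul_cancel₀ hD0, one_smul]

/-- Nilpotent `Y` for which `exp(iY)` lies over the crown domain of `GL` are uniformly bounded. -/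
theorem exists_bound_of_mem_crown (ι : Type*) [Fintype ι] [DecidableEq ι] :
    ∃ C : ℝ, ∀ (Y X : Matrix ι ι ℝ) (g : GL ι ℝ), IsNilpotent Y → HasSmallSpread X →
      exp (I • cplx Y) * (exp (I • cplx Y))ᵀ = cplx (g : Matrix ι ι ℝ) *
        (exp (I • cplx X) * (exp (I • cplx X))ᵀ) * (cplx (g : Matrix ι ι ℝ))ᵀ →
      ∀ i j, |Y i j| ≤ C := by
  obtain ⟨C, hC⟩ := exists_bound_of_cayley ι
  refine ⟨C, fun Y X g hY hX h => ?_⟩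
  obtain ⟨φ, hφ⟩ := exists_posDef_re_of_hasSmallSpread hX
  have := hφ g
  rw [← h] at this
  obtain ⟨R, ε, hR, hε, he⟩ := exists_cayley_of_posDef hY this
  exact hC R Y ε hR hε hY he

end Bound

/-! ### From cosets to matrices, embedding of crowns, and the group `SL`. -/

section Plumbing
variable {ι : Type*} [Fintype ι] [DecidableEq ι]

open NormedSpace Complex

theorem mem_complexOrthogonal {k : GL ι ℂ} :
    k ∈ complexOrthogonal ι ↔ (k : Matrix ι ι ℂ)ᵀ * (k : Matrix ι ι ℂ) = 1 := Iff.rfl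

theorem smul_basePoint_eq_iff {G : Subgroup (GL ι ℝ)} {a b : GL ι ℂ} :
    a • basePoint G = b • basePoint G ↔ a⁻¹ * b ∈ KC G := by
  rw [basePoint, MulAction.Quotient.smul_mk, MulAction.Quotient.smul_mk, smul_eq_mul, smul_eq_mul,
    mul_one, mul_one]
  exact QuotientGroup.eq

theorem mul_transpose_eq_of_mem_complexOrthogonal {a b : GL ι ℂ}
    (h : a⁻¹ * b ∈ complexOrthogonal ι) :
    (a : Matrix ι ι ℂ) * (a : Matrix ι ι ℂ)ᵀ = (b : Matrix ι ι ℂ) * (b : Matrix ι ι ℂ)ᵀ := by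
  set k := a⁻¹ * b with hk
  have hb : b = a * k := by rw [hk, mul_inv_cancel_left]
  have hk' : (k : Matrix ι ι ℂ) * (k : Matrix ι ι ℂ)ᵀ = 1 :=
    mul_eq_one_comm.1 (mem_complexOrthogonal.1 h)
  rw [hb, Units.val_mul, Matrix.transpose_mul, Matrix.mul_assoc, ← Matrix.mul_assoc _ _ᵀ, hk',
    Matrix.one_mul]

/-- A set of nilpotent matrices `Y` is bounded if all points `exp(iY)` lie over the crown domain
of `GL`. -/
theorem isBoundedSet_of_forall_exists {S : Set (Matrix ι ι ℝ)}
    (hS : ∀ Y ∈ S, IsNilpotent Y ∧ ∃ (g : GL ι ℝ) (X : Matrix ι ι ℝ), HasSmallSpread X ∧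
      (expI Y)⁻¹ * (toComplex g * expI X) ∈ complexOrthogonal ι) : IsBoundedSet S := by
  obtain ⟨C, hC⟩ := exists_bound_of_mem_crown ι
  refine ⟨C, fun Y hY => ?_⟩
  obtain ⟨hnil, g, X, hX, hk⟩ := hS Y hY
  refine hC Y X g hnil hX ?_
  have h := mul_transpose_eq_of_mem_complexOrthogonal hk
  rw [coe_expI, Units.val_mul, coe_expI, coe_toComplex, Matrix.transpose_mul] at h
  rw [h]
  simp only [Matrix.mul_assoc]

theorem isBoundedSet_Lambda_of_hasSmallSpread {G : Subgroup (GL ι ℝ)}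
    {𝔞 : Submodule ℝ (Matrix ι ι ℝ)} {Φ : Set (Module.Dual ℝ 𝔞)} (h𝔞 : IsAbelianInS G 𝔞)
    (hΦ : IsPositiveSystem G 𝔞 Φ) (hΩ : ∀ X ∈ Omega G 𝔞, HasSmallSpread X) :
    IsBoundedSet (Lambda G 𝔞 Φ) := by
  refine isBoundedSet_of_forall_exists fun Y hY => ?_
  obtain ⟨hYn, g, -, X, hX, h⟩ := connectedComponentIn_subset _ _ hY
  exact ⟨isNilpotent_of_mem_nilradical h𝔞 hΦ hYn, g, X, hΩ X hX, (smul_basePoint_eq_iff.1 h).2⟩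

theorem hasSmallSpread_of_mem_Omega_top {𝔟 : Submodule ℝ (Matrix ι ι ℝ)}
    (h𝔟 : IsAbelianInS ⊤ 𝔟) {X : Matrix ι ι ℝ} (hX : X ∈ Omega ⊤ 𝔟) : HasSmallSpread X :=
  hasSmallSpread_of_nilpotent_mem h𝔟 (fun _ _ _ => Subgroup.mem_top _) hX

theorem quotientMap_smul_basePoint {G H : Subgroup (GL ι ℝ)} (h : G ≤ H) (a : GL ι ℂ) :
    Subgroup.quotientMapOfLE (KC_mono h) (a • basePoint G) = a • basePoint H := by
  rw [basePoint, basePoint, MulAction.Quotient.smul_mk, MulAction.Quotient.smul_mk]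
  exact Subgroup.quotientMapOfLE_apply_mk _ _

theorem isBoundedSet_Lambda_of_crownEmbeds {G : Subgroup (GL ι ℝ)}
    {𝔞 𝔟 : Submodule ℝ (Matrix ι ι ℝ)} {Φ : Set (Module.Dual ℝ 𝔞)} (h𝔞 : IsAbelianInS G 𝔞)
    (hΦ : IsPositiveSystem G 𝔞 Φ) (h𝔟 : IsAbelianInS ⊤ 𝔟) (hG : CrownEmbeds G 𝔞 𝔟) :
    IsBoundedSet (Lambda G 𝔞 Φ) := by
  refine isBoundedSet_of_forall_exists fun Y hY => ?_
  obtain ⟨hYn, hYc⟩ := connectedComponentIn_subset _ _ hY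
  obtain ⟨g, -, X, hX, h⟩ := hG hYc
  rw [quotientMap_smul_basePoint le_top] at h
  exact ⟨isNilpotent_of_mem_nilradical h𝔞 hΦ hYn, g, X, hasSmallSpread_of_mem_Omega_top h𝔟 hX,
    (smul_basePoint_eq_iff.1 h).2⟩

theorem toComplex_mem_KC_top {g : GL ι ℝ}
    (hg : (g : Matrix ι ι ℝ)ᵀ * (g : Matrix ι ι ℝ) = 1) :
    toComplex g ∈ KC (⊤ : Subgroup (GL ι ℝ)) := by
  refine ⟨?_, ?_⟩
  · refine Subgroup.mem_sInf.2 fun H hH => hH.2 ⟨g, Subgroup.mem_top _, rfl⟩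
  · change (toComplex g : Matrix ι ι ℂ)ᵀ * (toComplex g : Matrix ι ι ℂ) = 1
    rw [coe_toComplex, ← cplx_transpose, ← map_mul, hg,
      map_one]

/-- A maximal abelian subspace of the symmetric matrices consists of all the matrices that are
diagonal in a suitable orthonormal basis. -/
theorem exists_eq_conj_diagonal {𝔟 : Submodule ℝ (Matrix ι ι ℝ)} (h𝔟 : IsMaximalAbelian ⊤ 𝔟) :
    ∃ V : Matrix ι ι ℝ, Vᵀ * V = 1 ∧ V * Vᵀ = 1 ∧
      (∀ d : ι → ℝ, V * Matrix.diagonal d * Vᵀ ∈ 𝔟) := by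
  obtain ⟨V, μ, hV, hV', hμ⟩ :=
    exists_simultaneous_diagonalization 𝔟 (fun X hX => (h𝔟.1.1 X hX).2) h𝔟.1.2
  let L : (ι → ℝ) →ₗ[ℝ] Matrix ι ι ℝ :=
    { toFun := fun d => V * Matrix.diagonal d * Vᵀ
      map_add' := by
        intro a b
        rw [← Matrix.add_mul, ← Matrix.mul_add, Matrix.diagonal_add]
        rfl
      map_smul' := by
        intro r a
        simp [Matrix.diagonal_smul] }
  have hL : LinearMap.range L = 𝔟 := by
    refine h𝔟.2 _ ⟨?_, ?_⟩ ?_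
    · rintro _ ⟨d, rfl⟩
      refine ⟨fun _ => Subgroup.mem_top _, ?_⟩
      change (V * Matrix.diagonal d * Vᵀ)ᵀ = V * Matrix.diagonal d * Vᵀ
      rw [Matrix.transpose_mul, Matrix.transpose_mul, Matrix.transpose_transpose,
        Matrix.diagonal_transpose, Matrix.mul_assoc]
    · rintro _ ⟨d, rfl⟩ _ ⟨e, rfl⟩
      have : ∀ d e : ι → ℝ, L d * L e = V * (Matrix.diagonal d * Matrix.diagonal e) * Vᵀ := by
        intro d e
        calc L d * L e = V * Matrix.diagonal d * (Vᵀ * V) * Matrix.diagonal e * Vᵀ := by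
              simp only [L, LinearMap.coe_mk, AddHom.coe_mk, Matrix.mul_assoc]
          _ = _ := by rw [hV, Matrix.mul_one]; simp only [Matrix.mul_assoc]
      rw [this, this, Matrix.diagonal_mul_diagonal, Matrix.diagonal_mul_diagonal]
      simp_rw [mul_comm]
    · intro X hX
      exact ⟨_, (hμ ⟨X, hX⟩).symm⟩
  refine ⟨V, hV, hV', fun d => ?_⟩
  rw [← hL]
  exact ⟨d, rfl⟩

/-- The orthogonal matrix `W = U Vᵀ` moves the eigenbasis of `𝔟` to that of `X`. On the left it is
absorbed into `g`, on the right into the stabilizer of the base point. -/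
theorem smul_basePoint_mem_crown_top {𝔟 : Submodule ℝ (Matrix ι ι ℝ)}
    (h𝔟 : IsMaximalAbelian ⊤ 𝔟) (g : GL ι ℝ) {X : Matrix ι ι ℝ} (hX : HasSmallSpread X) :
    (toComplex g * expI X) • basePoint ⊤ ∈ crown ⊤ 𝔟 := by
  obtain ⟨U, d, hU, hU', rfl, hd⟩ := hX
  obtain ⟨V, hV, hV', hVd⟩ := exists_eq_conj_diagonal h𝔟
  let W : GL ι ℝ := ⟨U * Vᵀ, V * Uᵀ,
    by rw [Matrix.mul_assoc, ← Matrix.mul_assoc Vᵀ, hV, Matrix.one_mul, hU'],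
    by rw [Matrix.mul_assoc, ← Matrix.mul_assoc Uᵀ, hU, Matrix.one_mul, hV']⟩
  have hW : (W : Matrix ι ι ℝ) = U * Vᵀ := rfl
  have hWW : (W : Matrix ι ι ℝ)ᵀ * (W : Matrix ι ι ℝ) = 1 := by
    rw [hW, Matrix.transpose_mul, Matrix.transpose_transpose, Matrix.mul_assoc,
      ← Matrix.mul_assoc Uᵀ, hU, Matrix.one_mul, hV']
  have hWi : ((W⁻¹ : GL ι ℝ) : Matrix ι ι ℝ) = (W : Matrix ι ι ℝ)ᵀ := by
    rw [hW, Matrix.transpose_mul, Matrix.transpose_transpose]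
    rfl
  have hconj : U * Matrix.diagonal d * Uᵀ =
      (W : Matrix ι ι ℝ) * (V * Matrix.diagonal d * Vᵀ) * (W : Matrix ι ι ℝ)ᵀ := by
    rw [hW, Matrix.transpose_mul, Matrix.transpose_transpose]
    calc _ = U * 1 * Matrix.diagonal d * 1 * Uᵀ := by rw [Matrix.mul_one, Matrix.mul_one]
      _ = _ := by rw [← hV]; simp only [Matrix.mul_assoc]
  refine ⟨g * W, Subgroup.mem_top _, V * Matrix.diagonal d * Vᵀ, ⟨hVd d, ?_⟩, ?_⟩
  -- Every root takes at this point a value `d i - d j`, so the spread condition is enough for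
  -- membership in `Omega`.
  · rintro α ⟨-, M, ⟨-, hM⟩, hM0⟩
    have h := hM ⟨_, hVd d⟩
    have hne := conj_ne_zero hV' hM0
    obtain ⟨i, j, hij⟩ : ∃ i j, (Vᵀ * M * V) i j ≠ 0 := by
      by_contra! h0
      exact hne (Matrix.ext h0)
    rw [← mul_right_cancel₀ hij (conj_bracket_apply hV d h i j)]
    exact hd i j
  · have h1 : expI (U * Matrix.diagonal d * Uᵀ) =
        toComplex W * expI (V * Matrix.diagonal d * Vᵀ) * toComplex W⁻¹ := by
      apply Units.ext
      rw [Units.val_mul, Units.val_mul, coe_expI, coe_expI, coe_toComplex, coe_toComplex, hWi,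
        hconj, exp_I_smul_cplx_conj hWW]
    rw [smul_basePoint_eq_iff]
    have h2 : (toComplex g * expI (U * Matrix.diagonal d * Uᵀ))⁻¹ *
        (toComplex (g * W) * expI (V * Matrix.diagonal d * Vᵀ)) = toComplex W := by
      rw [h1, map_mul, map_inv]
      group
    rw [h2]
    exact toComplex_mem_KC_top hWW

theorem embedsWithBoundedLambda_of_hasSmallSpread {G : Subgroup (GL ι ℝ)}
    (hΩ : ∀ 𝔞, IsAbelianInS G 𝔞 → ∀ X ∈ Omega G 𝔞, HasSmallSpread X) :
    EmbedsWithBoundedLambda G := by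
  refine ⟨fun 𝔞 𝔟 h𝔞 h𝔟 => ?_, fun 𝔞 Φ h𝔞 hΦ =>
    isBoundedSet_Lambda_of_hasSmallSpread h𝔞.1 hΦ (hΩ 𝔞 h𝔞.1)⟩
  rintro _ ⟨g, -, X, hX, rfl⟩
  rw [quotientMap_smul_basePoint le_top]
  exact smul_basePoint_mem_crown_top h𝔟 g (hΩ 𝔞 h𝔞.1 X hX)

theorem embedsWithBoundedLambda_slReal (n : ℕ) : EmbedsWithBoundedLambda (slReal n) := by
  refine embedsWithBoundedLambda_of_hasSmallSpread fun 𝔞 h𝔞 X hX =>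
    hasSmallSpread_of_nilpotent_mem h𝔞 (fun M hM t => ?_) hX
  rw [slReal, MonoidHom.mem_ker]
  apply Units.ext
  rw [Matrix.GeneralLinearGroup.val_det_apply, coe_expGL, Units.val_one]
  exact det_exp_of_isNilpotent (hM.smul t)

end Plumbing

/-! ### Groups preserving a bilinear form, and the symplectic group. -/

section Forms
variable {ι : Type*} [Fintype ι] [DecidableEq ι]

open NormedSpace

theorem exp_transpose_mul_mul_exp {M B : Matrix ι ι ℝ} (h : Mᵀ * B + B * M = 0) :
    (exp M)ᵀ * B * exp M = B := by
  have h1 : Mᵀ * B = B * -M := by rw [Matrix.mul_neg]; exact eq_neg_of_add_eq_zero_left h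
  rw [← Matrix.exp_transpose, exp_mul_of_mul_eq h1, Matrix.mul_assoc,
    ← Matrix.exp_add_of_commute _ _ (Commute.refl M).neg_left, neg_add_cancel, NormedSpace.exp_zero,
    Matrix.mul_one]

/-- Invariance rewrites as `exp(tX)ᵀ B = B exp(-tX)`, to be differentiated at `t = 0`. -/
theorem transpose_mul_eq_neg_of_exp {X B : Matrix ι ι ℝ}
    (h : ∀ t : ℝ, (exp (t • X))ᵀ * B * exp (t • X) = B) : Xᵀ * B = -(B * X) := by
  rw [← Matrix.mul_neg]
  refine mul_eq_of_exp_smul_mul fun t => ?_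
  have h1 : exp (t • X) * exp (t • -X) = 1 := by
    rw [← Matrix.exp_add_of_commute _ _ (by rw [smul_neg]; exact (Commute.refl _).neg_right),
      smul_neg, add_neg_cancel, NormedSpace.exp_zero]
  rw [← Matrix.transpose_smul, Matrix.exp_transpose]
  conv_rhs => rw [← h t]
  rw [Matrix.mul_assoc _ _ (exp (t • -X)), h1, Matrix.mul_one]

theorem mem_lieAlg_spReal {n : ℕ} {X : Matrix (Fin n ⊕ Fin n) (Fin n ⊕ Fin n) ℝ} :
    X ∈ lieAlg (spReal n) ↔
      ∀ t : ℝ, (exp (t • X))ᵀ * Matrix.J (Fin n) ℝ * exp (t • X) = Matrix.J (Fin n) ℝ :=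
  forall_congr' fun _ => SymplecticGroup.mem_iff'

theorem vecMulVec_add_vecMulVec_ne_zero {κ : Type*} {v w : κ → ℝ} (hv : v ≠ 0) (hw : w ≠ 0) :
    Matrix.vecMulVec v w + Matrix.vecMulVec w v ≠ 0 := by
  intro h
  have h1 : ∀ i j, v i * w j + w i * v j = 0 := fun i j => congrFun (congrFun h i) j
  obtain ⟨i, hi⟩ := Function.ne_iff.1 hv
  rw [Pi.zero_apply] at hi
  have hwi : w i = 0 := by
    have := h1 i i
    have h2 : v i * w i = 0 := by linarith
    exact (mul_eq_zero.1 h2).resolve_left hi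
  refine hw (funext fun j => ?_)
  have := h1 i j
  rw [hwi, zero_mul, add_zero] at this
  exact (mul_eq_zero.1 this).resolve_left hi

/-- Elements of `𝔞` anticommute with `J`, so `w' = J w` has weight `-ν`. For the symmetric tensor
`S` of `v` and `w'`, the matrix `S J` lies in the Lie algebra and `H S J - S J H = (H S + S H) J =
(μ - ν)(H) S J`. -/
theorem embedsWithBoundedLambda_spReal (n : ℕ) : EmbedsWithBoundedLambda (spReal n) := by
  refine embedsWithBoundedLambda_of_hasSmallSpread fun 𝔞 h𝔞 X hX =>
    hasSmallSpread_of_weights h𝔞 (fun v w μ ν hv hw hvμ hwν _ => ?_) hX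
  set J := Matrix.J (Fin n) ℝ with hJ
  have hJJ : J * J = -1 := Matrix.J_squared _ _
  have hJt : Jᵀ = -J := Matrix.J_transpose _ _
  have hHJ : ∀ H : 𝔞, (H : Matrix _ _ ℝ) * J = -(J * (H : Matrix _ _ ℝ)) := by
    intro H
    have h := transpose_mul_eq_neg_of_exp (mem_lieAlg_spReal.1 (h𝔞.1 H H.2).1)
    rwa [(h𝔞.1 H H.2).2.eq] at h
  set w' := J *ᵥ w with hw'
  have hw'0 : w' ≠ 0 := by
    intro h
    apply hw
    have : J *ᵥ w' = -w := by rw [hw', Matrix.mulVec_mulVec, hJJ, Matrix.neg_mulVec,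
      Matrix.one_mulVec]
    rw [h, Matrix.mulVec_zero] at this
    exact neg_eq_zero.1 this.symm
  have hw'ν : ∀ H : 𝔞, (H : Matrix _ _ ℝ) *ᵥ w' = -(ν H • w') := by
    intro H
    rw [hw', Matrix.mulVec_mulVec, hHJ, Matrix.neg_mulVec, ← Matrix.mulVec_mulVec, hwν,
      Matrix.mulVec_smul]
  set S := Matrix.vecMulVec v w' + Matrix.vecMulVec w' v with hS
  have hSt : Sᵀ = S := by
    rw [hS, Matrix.transpose_add, Matrix.transpose_vecMulVec, Matrix.transpose_vecMulVec, add_comm]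
  refine ⟨S * J, ⟨?_, fun H => ?_⟩, fun h => ?_⟩
  · refine mem_lieAlg_spReal.2 fun t => exp_transpose_mul_mul_exp ?_
    rw [Matrix.transpose_smul, Matrix.transpose_mul, hSt, hJt]
    simp only [Matrix.smul_mul, Matrix.mul_smul, Matrix.neg_mul, Matrix.mul_assoc]
    rw [smul_neg, neg_add_cancel]
  · have hvec : ∀ u : Fin n ⊕ Fin n → ℝ, u ᵥ* H.1 = H.1 *ᵥ u := by
      intro u
      rw [← Matrix.mulVec_transpose, (h𝔞.1 H H.2).2.eq]
    have e : S * J * (H : Matrix _ _ ℝ) = -(S * (H : Matrix _ _ ℝ)) * J := by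
      rw [Matrix.mul_assoc, Matrix.neg_mul, Matrix.mul_assoc S, hHJ, Matrix.mul_neg, neg_neg]
    rw [e, ← Matrix.mul_assoc, ← Matrix.sub_mul, ← Matrix.smul_mul]
    congr 1
    rw [hS, Matrix.mul_add, Matrix.add_mul, Matrix.mul_vecMulVec, Matrix.mul_vecMulVec,
      Matrix.vecMulVec_mul, Matrix.vecMulVec_mul, hvec, hvec, hvμ, hw'ν, LinearMap.sub_apply]
    ext i j
    simp only [Matrix.sub_apply, Matrix.add_apply, Matrix.neg_apply, Matrix.smul_apply,
      Matrix.vecMulVec_apply, Pi.smul_apply, Pi.neg_apply, smul_eq_mul]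
    ring
  · have h1 : S * J * J = 0 := by rw [h, Matrix.zero_mul]
    rw [Matrix.mul_assoc, hJJ, Matrix.mul_neg, Matrix.mul_one, neg_eq_zero] at h1
    exact vecMulVec_add_vecMulVec_ne_zero hv hw'0 h1

end Forms

/-! ### Vectors and tensors over a division algebra. -/

section Coordinates
variable {m κ D : Type*} [DivisionRing D] [Algebra ℝ D] (b : Module.Basis κ ℝ D)

/-- The real coordinates of a vector over `D`. -/
def realVec (v : m → D) : m × κ → ℝ := fun i => b.repr (v i.1) i.2

theorem realVec_surjective [Fintype κ] : Function.Surjective (realVec b : (m → D) → _) := by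
  intro v
  refine ⟨fun i => b.equivFun.symm fun a => v (i, a), funext fun i => ?_⟩
  change b.equivFun (b.equivFun.symm fun a => v (i.1, a)) i.2 = v i
  rw [LinearEquiv.apply_symm_apply]

theorem realVec_injective : Function.Injective (realVec b : (m → D) → _) := by
  intro v w h
  ext i
  refine b.repr.injective (Finsupp.ext fun a => ?_)
  exact congrFun h (i, a)

theorem realVec_smul (r : ℝ) (v : m → D) : realVec b (r • v) = r • realVec b v := by
  ext i
  simp [realVec]

theorem realVec_zero : realVec b (0 : m → D) = 0 := by
  ext i
  simp [realVec]

end Coordinates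

/-- A rank one tensor over `D` has, up to rescaling, a nonzero skew-hermitian part. -/
theorem exists_skew_tensor_ne_zero {n D : Type*} [DivisionRing D] [StarRing D]
    (hD : ∃ d : D, star d ≠ d) {v w : n → D}
    (hv : v ≠ 0) (hw : w ≠ 0) :
    ∃ c : D, Matrix.vecMulVec (fun i => v i * c) (star w) -
      Matrix.vecMulVec w (star fun i => v i * c) ≠ 0 := by
  obtain ⟨d, hd⟩ := hD
  by_cases hvw : ∃ i, v i ≠ 0 ∧ w i ≠ 0
  · obtain ⟨i, hvi, hwi⟩ := hvw
    have hwi' : star (w i) ≠ 0 := star_ne_zero.2 hwi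
    have hval : v i * ((v i)⁻¹ * d * (star (w i))⁻¹) * star (w i) = d := by
      rw [← mul_assoc, ← mul_assoc, mul_inv_cancel₀ hvi, one_mul, mul_assoc, inv_mul_cancel₀ hwi',
        mul_one]
    -- This scalar makes the `(i, i)` entry of the first tensor equal to `d`, so that of the
    -- difference is `d - star d`.
    refine ⟨(v i)⁻¹ * d * (star (w i))⁻¹, fun h => hd ?_⟩
    have h1 := congrFun (congrFun h i) i
    rw [Matrix.sub_apply, Matrix.vecMulVec_apply, Matrix.vecMulVec_apply, Pi.star_apply,
      Pi.star_apply, Matrix.zero_apply, sub_eq_zero, ← star_star (w i), ← star_mul, star_star,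
      hval] at h1
    exact h1.symm
  -- With disjoint supports, the second tensor vanishes at `(i, j)` and the first does not.
  · push Not at hvw
    obtain ⟨i, hi⟩ := Function.ne_iff.1 hv
    obtain ⟨j, hj⟩ := Function.ne_iff.1 hw
    refine ⟨1, fun h => ?_⟩
    have h1 := congrFun (congrFun h i) j
    rw [Matrix.sub_apply, Matrix.vecMulVec_apply, Matrix.vecMulVec_apply, hvw i hi, zero_mul,
      sub_zero, mul_one] at h1
    exact mul_ne_zero hi (star_ne_zero.2 hj) h1

/-! ### Restriction of scalars and unitary groups over `D`. -/

section Realification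
variable {m κ : Type*} [Fintype m] [DecidableEq m] [Fintype κ] [DecidableEq κ]
  {D : Type*} [DivisionRing D] [Algebra ℝ D] (b : Module.Basis κ ℝ D)

open NormedSpace

/-- Restriction of scalars for matrices, as an algebra homomorphism. -/
def realAlgHom : Matrix m m D →ₐ[ℝ] Matrix (m × κ) (m × κ) ℝ :=
  (Matrix.compAlgEquiv m κ ℝ ℝ).toAlgHom.comp (Algebra.leftMulMatrix b).mapMatrix

theorem realAlgHom_apply (A : Matrix m m D) (i j : m × κ) :
    realAlgHom b A i j = Algebra.leftMulMatrix b (A i.1 j.1) i.2 j.2 := rfl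

theorem coe_realify (g : (Matrix m m D)ˣ) :
    (realify b g : Matrix (m × κ) (m × κ) ℝ) = realAlgHom b (g : Matrix m m D) := rfl

theorem realAlgHom_injective : Function.Injective (realAlgHom b : Matrix m m D → _) := by
  intro A B h
  ext i j
  refine Algebra.leftMulMatrix_injective b (Matrix.ext fun a c => ?_)
  exact congrFun (congrFun h (i, a)) (j, c)

theorem realAlgHom_mulVec (A : Matrix m m D) (v : m → D) :
    realAlgHom b A *ᵥ realVec b v = realVec b (A *ᵥ v) := by
  ext i
  have h : ∀ j, ∑ a, Algebra.leftMulMatrix b (A i.1 j) i.2 a * b.repr (v j) a =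
      b.repr (A i.1 j * v j) i.2 := by
    intro j
    exact congrFun (Algebra.leftMulMatrix_mulVec_repr b (A i.1 j) (v j)) i.2
  simp only [Matrix.mulVec, dotProduct, realVec, realAlgHom_apply, Fintype.sum_prod_type, h,
    map_sum, Finsupp.coe_finsetSum, Finset.sum_apply]

theorem isClosed_range_realAlgHom :
    IsClosed ((realAlgHom b : Matrix m m D →ₐ[ℝ] _).range : Set (Matrix (m × κ) (m × κ) ℝ)) := by
  open scoped Matrix.Norms.Operator in
  exact (Subalgebra.toSubmodule (realAlgHom b).range).closed_of_finiteDimensional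

/-- The image of the matrices over `D` is a closed subalgebra, hence closed under `exp`; the
exponential of `-N` supplies the inverse. -/
theorem exists_realify_eq_expGL (N : Matrix m m D) :
    ∃ g : (Matrix m m D)ˣ, realify b g = expGL (realAlgHom b N) := by
  have h : ∀ N : Matrix m m D, ∃ A : Matrix m m D, realAlgHom b A = exp (realAlgHom b N) :=
    fun N => NormedSpace.exp_mem (s := (realAlgHom b).range) (isClosed_range_realAlgHom b) ⟨N, rfl⟩
  obtain ⟨A, hA⟩ := h N
  obtain ⟨B, hB⟩ := h (-N)
  have hAB : A * B = 1 := by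
    apply realAlgHom_injective b
    rw [map_mul, hA, hB, map_neg, ← Matrix.exp_add_of_commute _ _
      (Commute.refl (realAlgHom b N)).neg_right, add_neg_cancel, NormedSpace.exp_zero, map_one]
  have hBA : B * A = 1 := by
    apply realAlgHom_injective b
    rw [map_mul, hA, hB, map_neg, ← Matrix.exp_add_of_commute _ _
      (Commute.refl (realAlgHom b N)).neg_left, neg_add_cancel, NormedSpace.exp_zero, map_one]
  exact ⟨⟨A, B, hAB, hBA⟩, Units.ext hA⟩

variable [StarRing D]

theorem realAlgHom_conjTranspose
    (hb : ∀ d, Algebra.leftMulMatrix b (star d) = (Algebra.leftMulMatrix b d)ᵀ)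
    (A : Matrix m m D) : realAlgHom b Aᴴ = (realAlgHom b A)ᵀ := by
  ext i j
  rw [realAlgHom_apply, Matrix.conjTranspose_apply, hb]
  rfl

/-- The analogue of the symplectic case: `η` anticommutes with `𝔞`, so `η w` has weight `-ν`, and `S
η` with `S` a skew-hermitian tensor is the root vector. Only nilpotent elements are asked of the Lie
algebra, so that the determinant condition of `SU` causes no obstruction. -/
theorem hasSmallSpread_of_unitary [StarModule ℝ D] (hD : ∃ d : D, star d ≠ d)
    (hb : ∀ d, Algebra.leftMulMatrix b (star d) = (Algebra.leftMulMatrix b d)ᵀ)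
    {η : Matrix m m D} (hη : ηᴴ = η) (hηη : η * η = 1) {G : Subgroup (GL (m × κ) ℝ)}
    (hG : ∀ g ∈ G, ∃ A : Matrix m m D, realAlgHom b A = (g : Matrix (m × κ) (m × κ) ℝ) ∧
      Aᴴ * η * A = η)
    (hG' : ∀ M : Matrix m m D, Mᴴ * η + η * M = 0 → IsNilpotent M → realAlgHom b M ∈ lieAlg G)
    {𝔞 : Submodule ℝ (Matrix (m × κ) (m × κ) ℝ)} (h𝔞 : IsAbelianInS G 𝔞)
    {X : Matrix (m × κ) (m × κ) ℝ} (hX : X ∈ Omega G 𝔞) : HasSmallSpread X := by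
  have hinj := realAlgHom_injective (m := m) b
  have hH : ∀ H : 𝔞, ∃ h : Matrix m m D, realAlgHom b h = H ∧ hᴴ = h ∧ h * η = -(η * h) := by
    intro H
    obtain ⟨hHl, hHs⟩ := h𝔞.1 H H.2
    -- A real matrix in `𝔞` is `D`-linear because all `exp(tH)` are.
    have hrange : (H : Matrix (m × κ) (m × κ) ℝ) ∈
        Subalgebra.toSubmodule (realAlgHom (m := m) b).range := by
      refine mem_of_exp_smul_mem _ fun t => ?_
      obtain ⟨A, hA, -⟩ := hG _ (hHl t)
      exact ⟨A, hA⟩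
    obtain ⟨h, hh⟩ := hrange
    have hh : realAlgHom b h = H := hh
    have hsym : hᴴ = h := hinj (by rw [realAlgHom_conjTranspose b hb, hh, hHs.eq])
    refine ⟨h, hh, hsym, hinj ?_⟩
    have h1 : (H : Matrix (m × κ) (m × κ) ℝ)ᵀ * realAlgHom b η =
        -(realAlgHom b η * (H : Matrix (m × κ) (m × κ) ℝ)) := by
      refine transpose_mul_eq_neg_of_exp fun t => ?_
      obtain ⟨A, hA, hA'⟩ := hG _ (hHl t)
      rw [coe_expGL] at hA
      rw [← hA, ← realAlgHom_conjTranspose b hb, ← map_mul, ← map_mul, hA']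
    rw [hHs.eq] at h1
    rw [map_mul, map_neg, map_mul, hh, h1]
  refine hasSmallSpread_of_weights h𝔞 (fun v w μ ν hv hw hvμ hwν hne => ?_) hX
  obtain ⟨v, rfl⟩ := realVec_surjective b v
  obtain ⟨w, rfl⟩ := realVec_surjective b w
  have hv0 : v ≠ 0 := fun h => hv (by rw [h, realVec_zero])
  have hw0 : η *ᵥ w ≠ 0 := by
    intro h
    have h1 : η *ᵥ (η *ᵥ w) = w := by rw [Matrix.mulVec_mulVec, hηη, Matrix.one_mulVec]
    rw [h, Matrix.mulVec_zero] at h1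
    exact hw (by rw [← h1, realVec_zero])
  obtain ⟨c, hc⟩ := exists_skew_tensor_ne_zero hD hv0 hw0
  -- Scalars act on the right, hence commute with `h` and preserve the weight of `v`.
  set v' : m → D := fun i => v i * c with hv'
  set w' : m → D := η *ᵥ w with hw'
  set S := Matrix.vecMulVec v' (star w') - Matrix.vecMulVec w' (star v') with hS
  have hSS : Sᴴ = -S := by
    rw [hS, Matrix.conjTranspose_sub, Matrix.conjTranspose_vecMulVec,
      Matrix.conjTranspose_vecMulVec, star_star, star_star, neg_sub]
  have hroot : ∀ H : 𝔞, (H : Matrix (m × κ) (m × κ) ℝ) * realAlgHom b (S * η) -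
      realAlgHom b (S * η) * (H : Matrix (m × κ) (m × κ) ℝ) =
      (μ - ν) H • realAlgHom b (S * η) := by
    intro H
    obtain ⟨h, hh, hsym, hanti⟩ := hH H
    have hv'μ : h *ᵥ v' = μ H • v' := by
      have h1 : h *ᵥ v = μ H • v := by
        apply realVec_injective b
        rw [← realAlgHom_mulVec, hh, hvμ, realVec_smul]
      ext i
      have h2 := congrFun h1 i
      simp only [Matrix.mulVec, dotProduct, hv', Pi.smul_apply] at h2 ⊢
      simp_rw [← mul_assoc, ← Finset.sum_mul, h2, smul_mul_assoc]
    have hw'ν : h *ᵥ w' = -(ν H • w') := by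
      have h1 : h *ᵥ w = ν H • w := by
        apply realVec_injective b
        rw [← realAlgHom_mulVec, hh, hwν, realVec_smul]
      rw [hw', Matrix.mulVec_mulVec, hanti, Matrix.neg_mulVec, ← Matrix.mulVec_mulVec, h1,
        Matrix.mulVec_smul]
    have hstar : ∀ u : m → D, star u ᵥ* h = star (h *ᵥ u) := by
      intro u
      rw [Matrix.star_mulVec, hsym]
    have e : S * η * h = -(S * h) * η := by
      rw [Matrix.mul_assoc, Matrix.neg_mul, Matrix.mul_assoc S, hanti, Matrix.mul_neg, neg_neg]
    rw [← hh, ← map_mul, ← map_mul, ← map_sub, ← map_smul, e, ← Matrix.mul_assoc,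
      ← Matrix.sub_mul, ← Matrix.smul_mul]
    congr 2
    rw [hS, Matrix.mul_sub, Matrix.sub_mul, Matrix.mul_vecMulVec, Matrix.mul_vecMulVec,
      Matrix.vecMulVec_mul, Matrix.vecMulVec_mul, hstar, hstar, hv'μ, hw'ν, LinearMap.sub_apply]
    ext i j
    simp only [Matrix.sub_apply, Matrix.neg_apply, Matrix.smul_apply, Matrix.vecMulVec_apply,
      Pi.smul_apply, Pi.neg_apply, Pi.star_apply, star_neg, star_smul, star_trivial, neg_mul,
      mul_neg, smul_mul_assoc, mul_smul_comm]
    module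
  refine ⟨realAlgHom b (S * η), ⟨hG' _ ?_ ?_, hroot⟩, fun h => ?_⟩
  · rw [Matrix.conjTranspose_mul, hSS, hη]
    simp only [Matrix.mul_neg, Matrix.neg_mul, Matrix.mul_assoc]
    rw [neg_add_cancel]
  · exact (IsNilpotent.map_iff hinj).1 (isNilpotent_of_bracket h𝔞 hne hroot)
  · have h1 : S * η = 0 := hinj (by rw [h, map_zero])
    have h2 : S * η * η = 0 := by rw [h1, Matrix.zero_mul]
    rw [Matrix.mul_assoc, hηη, Matrix.mul_one] at h2
    exact hc h2

theorem mem_indefiniteUnitary_of_realify_eq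
    (hb : ∀ d, Algebra.leftMulMatrix b (star d) = (Algebra.leftMulMatrix b d)ᵀ) {p q : ℕ}
    {N : Matrix (Fin p ⊕ Fin q) (Fin p ⊕ Fin q) D}
    (hN : Nᴴ * signature D p q + signature D p q * N = 0)
    {g : (Matrix (Fin p ⊕ Fin q) (Fin p ⊕ Fin q) D)ˣ}
    (hg : realify b g = expGL (realAlgHom b N)) : g ∈ indefiniteUnitary D p q := by
  change (g : Matrix (Fin p ⊕ Fin q) (Fin p ⊕ Fin q) D)ᴴ * signature D p q * g = signature D p q
  have hg' : realAlgHom b (g : Matrix (Fin p ⊕ Fin q) (Fin p ⊕ Fin q) D) =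
      exp (realAlgHom b N) := by rw [← coe_realify, hg, coe_expGL]
  apply realAlgHom_injective b
  rw [map_mul, map_mul, realAlgHom_conjTranspose b hb, hg']
  refine exp_transpose_mul_mul_exp ?_
  rw [← realAlgHom_conjTranspose b hb, ← map_mul, ← map_mul, ← map_add, hN, map_zero]

end Realification

/-! ### The groups `Sp(p, q)` and `SU(p, q)`. -/

theorem signature_conjTranspose (D : Type*) [Ring D] [StarRing D] (p q : ℕ) :
    (signature D p q)ᴴ = signature D p q := by
  rw [signature, Matrix.diagonal_conjTranspose]
  congr 1
  ext (i | i) <;> simp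

theorem signature_mul_self (D : Type*) [Ring D] (p q : ℕ) :
    signature D p q * signature D p q = 1 := by
  rw [signature, Matrix.diagonal_mul_diagonal, ← Matrix.diagonal_one]
  congr 1
  ext (i | i) <;> simp

theorem leftMulMatrix_basisOneI_star (z : ℂ) : Algebra.leftMulMatrix Complex.basisOneI (star z) =
    (Algebra.leftMulMatrix Complex.basisOneI z)ᵀ := by
  rw [Algebra.leftMulMatrix_complex, Algebra.leftMulMatrix_complex]
  ext i j
  fin_cases i <;> fin_cases j <;> simp

theorem quaternionBasis_repr (q : ℍ[ℝ]) :
    ⇑(quaternionBasis.repr q) = ![q.re, q.imI, q.imJ, q.imK] := rfl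

/-- The quaternion with given real coordinates. -/
def quat (a b c d : ℝ) : ℍ[ℝ] := ⟨a, b, c, d⟩

@[simp] theorem re_quat (a b c d : ℝ) : (quat a b c d).re = a := rfl

@[simp] theorem imI_quat (a b c d : ℝ) : (quat a b c d).imI = b := rfl

@[simp] theorem imJ_quat (a b c d : ℝ) : (quat a b c d).imJ = c := rfl

@[simp] theorem imK_quat (a b c d : ℝ) : (quat a b c d).imK = d := rfl

theorem coe_quaternionBasis :
    ⇑quaternionBasis = ![1, quat 0 1 0 0, quat 0 0 1 0, quat 0 0 0 1] := by
  ext i : 1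
  apply quaternionBasis.repr.injective
  rw [Module.Basis.repr_self]
  ext j
  rw [quaternionBasis_repr]
  fin_cases i <;> fin_cases j <;> simp

theorem leftMulMatrix_quaternionBasis_star (z : ℍ[ℝ]) :
    Algebra.leftMulMatrix quaternionBasis (star z) =
      (Algebra.leftMulMatrix quaternionBasis z)ᵀ := by
  ext i j
  rw [Matrix.transpose_apply, Algebra.leftMulMatrix_eq_repr_mul, Algebra.leftMulMatrix_eq_repr_mul,
    coe_quaternionBasis, quaternionBasis_repr, quaternionBasis_repr]
  fin_cases i <;> fin_cases j <;>
    simp [Quaternion.re_mul, Quaternion.imI_mul, Quaternion.imJ_mul, Quaternion.imK_mul]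

theorem embedsWithBoundedLambda_spPQ (p q : ℕ) : EmbedsWithBoundedLambda (spPQ p q) := by
  have : StarModule ℝ ℍ[ℝ] := ⟨fun s a => by rw [Quaternion.star_smul, star_trivial s]⟩
  refine embedsWithBoundedLambda_of_hasSmallSpread fun 𝔞 h𝔞 X hX =>
    hasSmallSpread_of_unitary quaternionBasis ⟨quat 0 1 0 0, fun h => ?_⟩
      leftMulMatrix_quaternionBasis_star (signature_conjTranspose _ p q) (signature_mul_self _ p q)
      ?_ (fun M hM _ t => ?_) h𝔞 hX
  · have := congrArg QuaternionAlgebra.imI h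
    rw [Quaternion.imI_star] at this
    norm_num at this
  · rintro _ ⟨g, hg, rfl⟩
    exact ⟨g, rfl, hg⟩
  · obtain ⟨g, hg⟩ := exists_realify_eq_expGL quaternionBasis (t • M)
    rw [← map_smul]
    refine ⟨g, mem_indefiniteUnitary_of_realify_eq quaternionBasis
      leftMulMatrix_quaternionBasis_star ?_ hg, hg⟩
    rw [Matrix.conjTranspose_smul, star_trivial, Matrix.smul_mul, Matrix.mul_smul, ← smul_add, hM,
      smul_zero]

theorem embedsWithBoundedLambda_suPQ (p q : ℕ) : EmbedsWithBoundedLambda (suPQ p q) := by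
  refine embedsWithBoundedLambda_of_hasSmallSpread fun 𝔞 h𝔞 X hX =>
    hasSmallSpread_of_unitary Complex.basisOneI ⟨Complex.I, fun h => ?_⟩
      leftMulMatrix_basisOneI_star (signature_conjTranspose _ p q) (signature_mul_self _ p q)
      ?_ (fun M hM hnil t => ?_) h𝔞 hX
  · have := congrArg Complex.im h
    simp at this
    linarith
  · rintro _ ⟨g, hg, rfl⟩
    exact ⟨g, rfl, hg.1⟩
  · obtain ⟨g, hg⟩ := exists_realify_eq_expGL Complex.basisOneI (t • M)
    rw [← map_smul]
    refine ⟨g, ⟨mem_indefiniteUnitary_of_realify_eq Complex.basisOneI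
      leftMulMatrix_basisOneI_star ?_ hg, ?_⟩, hg⟩
    · rw [Matrix.conjTranspose_smul, star_trivial, Matrix.smul_mul, Matrix.mul_smul, ← smul_add,
        hM, smul_zero]
    -- The complex determinant is `1` because `g` is unipotent, which may be tested after the
    -- injective restriction of scalars.
    · have hg' : realAlgHom Complex.basisOneI (g.1 - 1) =
          NormedSpace.exp (realAlgHom Complex.basisOneI (t • M)) - 1 := by
        rw [map_sub, ← coe_realify, hg, coe_expGL, map_one]
      have h1 : IsNilpotent (g.1 - 1) := by
        rw [← IsNilpotent.map_iff (realAlgHom_injective Complex.basisOneI), hg']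
        exact isNilpotent_exp_sub_one ((hnil.smul t).map _)
      have h2 := det_smul_one_sub_of_isNilpotent h1.neg 1
      rw [one_smul, sub_neg_eq_add, add_sub_cancel, one_pow] at h2
      refine MonoidHom.mem_ker.2 (Units.ext ?_)
      rw [Matrix.GeneralLinearGroup.val_det_apply, h2, Units.val_one]

end Crown

end

theorem proposition3p1 :
    -- the general linear group
    (∀ (n : ℕ) (𝔞 : Submodule ℝ (Matrix (Fin n) (Fin n) ℝ)) (Φ : Set (Module.Dual ℝ 𝔞)),
      Crown.IsMaximalAbelian ⊤ 𝔞 → Crown.IsPositiveSystem ⊤ 𝔞 Φ →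
      Crown.IsBoundedSet (Crown.Lambda ⊤ 𝔞 Φ)) ∧
    -- self-adjoint real algebraic groups whose crown embeds into that of the general linear group
    (∀ (n : ℕ) (G : Subgroup (GL (Fin n) ℝ)) (𝔞 𝔟 : Submodule ℝ (Matrix (Fin n) (Fin n) ℝ))
      (Φ : Set (Module.Dual ℝ 𝔞)),
      Crown.IsZariskiClosed G → Crown.IsSelfAdjoint G →
      Crown.IsMaximalAbelian G 𝔞 → Crown.IsPositiveSystem G 𝔞 Φ →
      Crown.IsMaximalAbelian (⊤ : Subgroup (GL (Fin n) ℝ)) 𝔟 → Crown.CrownEmbeds G 𝔞 𝔟 →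
      Crown.IsBoundedSet (Crown.Lambda G 𝔞 Φ)) ∧
    -- the classical examples
    (∀ n : ℕ, Crown.EmbedsWithBoundedLambda (Crown.slReal n)) ∧
    (∀ n : ℕ, Crown.EmbedsWithBoundedLambda (Crown.spReal n)) ∧
    (∀ p q : ℕ, Crown.EmbedsWithBoundedLambda (Crown.spPQ p q)) ∧
    (∀ p q : ℕ, Crown.EmbedsWithBoundedLambda (Crown.suPQ p q)) := by
  refine ⟨fun n 𝔞 Φ h𝔞 hΦ => ?_, fun n G 𝔞 𝔟 Φ _ _ h𝔞 hΦ h𝔟 hG => ?_,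
    Crown.embedsWithBoundedLambda_slReal, Crown.embedsWithBoundedLambda_spReal,
    Crown.embedsWithBoundedLambda_spPQ, Crown.embedsWithBoundedLambda_suPQ⟩
  · exact Crown.isBoundedSet_Lambda_of_hasSmallSpread h𝔞.1 hΦ fun X hX =>
      Crown.hasSmallSpread_of_mem_Omega_top h𝔞.1 hX
  · exact Crown.isBoundedSet_Lambda_of_crownEmbeds h𝔞.1 hΦ h𝔟.1 hG
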